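/- Let $A$ be the automorphism $A(w,z)=(w+z,z)$ of $\mathbb{T}^4=\mathbb{C}^2/\mathbb{Z}[i]^2$ (in real coordinates $w=x_1+iy_1$, $z=x_2+iy_2$ it is the integer matrix with rows $(1,0,1,0),(0,1,0,1),(0,0,1,0),(0,0,0,1)$). Let $M=(\mathbb{T}^4\times[0,1])/((t,0)\sim(At,1))$ be its suspension, with the foliation $\mathcal{F}$ whose leaves are the images of the lines $\{t\}\times\mathbb{R}$. It is transversely holomorphic of complex codimension $2$, with the complex structure of $\mathbb{T}^4$. A smooth form $\omega$ on $M$ is basic if $i_X\omega=i_Xd\omega=0$ for every $X$ tangent to the leaves. Let $\Omega^{p,q}$ be the space of basic complex valued forms of type $(p,q)$, write $d=\partial+\bar\partial$ on basic forms, and let $$H^{p,q}_{\bar\partial}=\frac{\ker\bar\partial\cap\Omega^{p,q}}{\operatorname{im}\bar\partial\cap\Omega^{p,q}},\quad H^{p,q}_{BC}=\frac{\ker\partial\cap\ker\bar\partial\cap\Omega^{p,q}}{\operatorname{im}\partial\bar\partial\cap\Omega^{p,q}},\quad H^{p,q}_{A}=\frac{\ker\partial\bar\partial\cap\Omega^{p,q}}{(\operatorname{im}\partial+\operatorname{im}\bar\partial)\cap\Omega^{p,q}}$$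 be the basic Dolbeault, Bott--Chern and Aeppli cohomology. Let $\mathcal{C}=\mathcal{C}^\infty(\mathbb{T}^2,\mathbb{C})$ be the space of smooth complex functions $g(z)$ on $\mathbb{T}^2=\mathbb{C}/\mathbb{Z}[i]$, and put $\theta=dw\wedge d\bar z+d\bar w\wedge dz$. 1. For $0\le p,q\le 2$ these cohomologies are, as complex vector spaces, as follows (columns $p$, rows $q$). Dolbeault: $$\begin{array}{c|ccc} q=2&\mathcal{C}&\mathbb{C}&\mathcal{C}\\ q=1&\mathbb{C}&\mathbb{C}\oplus\mathbb{C}&\mathbb{C}\\ q=0&\mathbb{C}&\mathbb{C}&\mathbb{C}\\ \hline &p=0&p=1&p=2\end{array}$$ Bott--Chern: $$\begin{array}{c|ccc} q=2&\mathbb{C}&\mathcal{C}&\mathcal{C}\\ q=1&\mathbb{C}&\mathbb{C}\oplus\mathbb{C}&\mathcal{C}\\ q=0&\mathbb{C}&\mathbb{C}&\mathbb{C}\\ \hline &p=0&p=1&p=2\end{array}$$ Aeppli: $$\begin{array}{c|ccc} q=2&\mathcal{C}&\mathbb{C}&\mathcal{C}\\ q=1&\mathbb{C}&\mathcal{C}\oplus\mathbb{C}&\mathbb{C}\\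 q=0&\mathbb{C}&\mathbb{C}&\mathcal{C}\\ \hline &p=0&p=1&p=2\end{array}$$ More precisely, for $(p,q)\ne(1,1)$ the isomorphism sends a constant $g\in\mathbb{C}$, respectively a function $g\in\mathcal{C}$, to the class of $g\,\eta^{p,q}$, where $\eta^{0,0}=1$, $\eta^{1,0}=dz$, $\eta^{0,1}=d\bar z$, $\eta^{2,0}=dw\wedge dz$, $\eta^{0,2}=d\bar w\wedge d\bar z$, $\eta^{2,1}=dw\wedge dz\wedge d\bar z$, $\eta^{1,2}=dz\wedge d\bar w\wedge d\bar z$, $\eta^{2,2}=dw\wedge dz\wedge d\bar w\wedge d\bar z$. In bidegree $(1,1)$ it sends $(c,a)$ to the class of $c\,\theta+a\,dz\wedge d\bar z$, with $a\in\mathbb{C}$ and with $c\in\mathbb{C}$ for Dolbeault and Bott--Chern, $c\in\mathcal{C}$ for Aeppli cohomology. 2. In particular $H^{2,0}_A$, $H^{1,1}_A$, $H^{0,2}_A$ and $H^{2,2}_A$ are infinite dimensional, while $H^{1,1}_{\bar\partial}$ is finite dimensional. 3. There is no Riemannian metric on the transverse manifold $\mathbb{T}^4$ that is invariant under $A$,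 so $\mathcal{F}$ is not Riemannian. The duality between Bott--Chern and Aeppli cohomology fails: for $0\le p,q\le2$ with $(p,q)\notin\{(1,0),(0,1)\}$, the spaces $H^{p,q}_{BC}$ and $H^{2-p,2-q}_A$ are not isomorphic, not even over $\mathbb{R}$. Serre duality fails: for $(p,q)\in\{(0,0),(2,2),(2,0),(0,2)\}$ the space $H^{p,q}_{\bar\partial}$ is isomorphic neither to the dual of $H^{2-p,2-q}_{\bar\partial}$ nor to $H^{2-p,2-q}_{\bar\partial}$, not even over $\mathbb{R}$. -/

import Mathlib

noncomputable section

namespace TorusSuspension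

open scoped ContDiff

/-! ### The suspension and its forms

The suspension `M = (𝕋⁴ × [0,1]) / ((t,0) ∼ (A t,1))` is the quotient of `ℂ² × ℝ` by the group generated by
the translations of `ℂ²` by `ℤ[i]²` and by `(t, s) ↦ (A t, s + 1)`, with `A (w, z) = (w + z, z)`; in the real
coordinates `(x₁, y₁, x₂, y₂)`, `w = x₁ + i y₁`, `z = x₂ + i y₂`, this is the integer matrix
`[[1,0,1,0],[0,1,0,1],[0,0,1,0],[0,0,0,1]]`. The leaves are the images of the lines `{t} × ℝ`. A smooth form
on `M` is a smooth form on `ℂ² × ℝ` that is invariant under this group. -/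

/-- The universal cover `ℂ² × ℝ` of the suspension, with coordinates `((w, z), s)`. -/
abbrev Cover : Type := (ℂ × ℂ) × ℝ

/-- Complex valued differential `k`-forms on the cover. -/
abbrev KForm (k : ℕ) : Type := Cover → Cover [⋀^Fin k]→L[ℝ] ℂ

/-- Families of forms, one in each degree. -/
abbrev RawForm : Type := (k : ℕ) → KForm k

/-- The Gaussian integer `m + n i`. -/
def gauss (m n : ℤ) : ℂ := (m : ℂ) + (n : ℂ) * Complex.I

/-- The map `A (w, z) = (w + z, z)`. -/
def shear : (ℂ × ℂ) →L[ℝ] (ℂ × ℂ) :=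
  (ContinuousLinearMap.fst ℝ ℂ ℂ + ContinuousLinearMap.snd ℝ ℂ ℂ).prod (ContinuousLinearMap.snd ℝ ℂ ℂ)

/-- The linear part `(t, s) ↦ (A t, s)` of the monodromy. -/
def monoLin : Cover →L[ℝ] Cover := shear.prodMap (ContinuousLinearMap.id ℝ ℝ)

/-- The monodromy `(t, s) ↦ (A t, s + 1)`. -/
def mono (x : Cover) : Cover := (shear x.1, x.2 + 1)

/-- A basic `k`-form of the suspension foliation: a smooth form, invariant under the deck group, with
`i_X α = 0` and `i_X dα = 0` for every vector `X` tangent to the leaves. -/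
structure IsBasic {k : ℕ} (α : KForm k) : Prop where
  smooth : ContDiff ℝ ∞ α
  lattice : ∀ (m n m' n' : ℤ) (x : Cover), α (x + ((gauss m n, gauss m' n'), 0)) = α x
  mono : ∀ (x : Cover) (v : Fin k → Cover), α (mono x) (fun i => monoLin (v i)) = α x v
  contr : ∀ (x : Cover) (v : Fin k → Cover) (i : Fin k), (v i).1 = 0 → α x v = 0
  contr_d : ∀ (x : Cover) (v : Fin (k + 1) → Cover) (i : Fin (k + 1)),
    (v i).1 = 0 → extDeriv α x v = 0

lemma fderiv_eval {k : ℕ} {α : KForm k} (h : ContDiff ℝ ∞ α) (x u : Cover) (v : Fin k → Cover) :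
    fderiv ℝ α x u v = fderiv ℝ (fun y => α y v) x u := by
  have h1 : HasFDerivAt α (fderiv ℝ α x) x := (h.differentiable (by simp) x).hasFDerivAt
  have h2 := ((ContinuousAlternatingMap.apply ℝ Cover ℂ v).hasFDerivAt.comp x h1).fderiv
  have h3 : (fun y => α y v) = (ContinuousAlternatingMap.apply ℝ Cover ℂ v) ∘ α := rfl
  rw [h3, h2]; rfl

lemma fderiv_contr {k : ℕ} {α : KForm k} (h : ContDiff ℝ ∞ α)
    (hc : ∀ (x : Cover) (v : Fin k → Cover) (i : Fin k), (v i).1 = 0 → α x v = 0)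
    (x u : Cover) (v : Fin k → Cover) (i : Fin k) (hi : (v i).1 = 0) : fderiv ℝ α x u v = 0 := by
  rw [fderiv_eval h]
  have : (fun y => α y v) = fun _ => 0 := by funext y; exact hc y v i hi
  rw [this]; simp

/-- A basic form does not change along the leaves. -/
lemma IsBasic.fderiv_vert {k : ℕ} {α : KForm k} (h : IsBasic α) (x u : Cover) (hu : u.1 = 0) :
    fderiv ℝ α x u = 0 := by
  ext v
  have h0 := h.contr_d x (Fin.cons u v) 0 (by simpa using hu)
  rw [extDeriv, ContinuousAlternatingMap.alternatizeUncurryFin_apply, Fin.sum_univ_succ] at h0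
  rw [Finset.sum_eq_zero] at h0
  · simpa using h0
  · intro i _
    obtain ⟨n, rfl⟩ : ∃ n, k = n + 1 := ⟨k - 1, by have := i.2; omega⟩
    rw [fderiv_contr h.smooth h.contr _ _ _ 0, smul_zero]
    simpa [Fin.removeNth] using hu

lemma IsBasic.transl {k : ℕ} {α : KForm k} (h : IsBasic α) (x u : Cover) (hu : u.1 = 0) :
    α (x + u) = α x := by
  have hd : ∀ r : ℝ, HasDerivAt (fun r : ℝ => α (x + r • u)) 0 r := by
    intro r
    have h1 : HasFDerivAt α (fderiv ℝ α (x + r • u)) (x + r • u) :=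
      (h.smooth.differentiable (by simp) _).hasFDerivAt
    have h2 : HasDerivAt (fun r : ℝ => x + r • u) u r := by
      simpa using ((hasDerivAt_id r).smul_const u).const_add x
    have h3 := h1.comp_hasDerivAt r h2
    rwa [h.fderiv_vert _ _ hu] at h3
  have := is_const_of_deriv_eq_zero (fun r => (hd r).differentiableAt) (fun r => (hd r).deriv) 1 0
  simpa using this

lemma contr_d_of_transl {k : ℕ} {α : KForm k} (h : ContDiff ℝ ∞ α)
    (hc : ∀ (x : Cover) (v : Fin k → Cover) (i : Fin k), (v i).1 = 0 → α x v = 0)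
    (ht : ∀ x u : Cover, u.1 = 0 → α (x + u) = α x)
    (x : Cover) (v : Fin (k + 1) → Cover) (i : Fin (k + 1)) (hi : (v i).1 = 0) :
    extDeriv α x v = 0 := by
  rw [extDeriv, ContinuousAlternatingMap.alternatizeUncurryFin_apply]
  refine Finset.sum_eq_zero fun j _ => ?_
  by_cases hj : j = i
  · subst hj
    have h1 : HasFDerivAt α (fderiv ℝ α x) x := (h.differentiable (by simp) _).hasFDerivAt
    have h2 : HasDerivAt (fun r : ℝ => x + r • v j) (v j) 0 := by
      simpa using ((hasDerivAt_id (0 : ℝ)).smul_const (v j)).const_add x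
    have h3 := HasFDerivAt.comp_hasDerivAt (0 : ℝ) (by simpa using h1) h2
    have h4 : (α ∘ fun r : ℝ => x + r • v j) = fun _ => α x := by
      funext r
      exact ht x _ (by simp [hi])
    rw [h4] at h3
    rw [h3.unique (hasDerivAt_const _ _)]
    simp
  · obtain ⟨l, rfl⟩ := Fin.exists_succAbove_eq (Ne.symm hj)
    rw [fderiv_contr h hc _ _ _ l, smul_zero]
    simpa [Fin.removeNth] using hi

/-- The basic forms `Ω^•(M/𝓕, ℂ)`, all degrees together. -/
def basicForms : Submodule ℂ RawForm where
  carrier := {α | ∀ k, IsBasic (α k)}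
  add_mem' := by
    intro a b ha hb k
    refine ⟨(ha k).smooth.add (hb k).smooth, fun m n m' n' x => ?_, fun x v => ?_, fun x v i hi => ?_,
      fun x v i hi => ?_⟩
    · simp [(ha k).lattice, (hb k).lattice]
    · simp [(ha k).mono, (hb k).mono]
    · simp [(ha k).contr x v i hi, (hb k).contr x v i hi]
    · have := extDeriv_add ((ha k).smooth.differentiable (by simp) x)
        ((hb k).smooth.differentiable (by simp) x)
      rw [Pi.add_apply, this]
      simp [(ha k).contr_d x v i hi, (hb k).contr_d x v i hi]
  zero_mem' := by
    intro k
    refine ⟨contDiff_const, ?_, ?_, ?_, ?_⟩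
    · intros; rfl
    · intros; rfl
    · intros; rfl
    · refine contr_d_of_transl contDiff_const ?_ ?_
      · intros; rfl
      · intros; rfl
  smul_mem' := by
    intro c a ha k
    refine ⟨(ha k).smooth.const_smul c, fun m n m' n' x => ?_, fun x v => ?_, fun x v i hi => ?_, ?_⟩
    · simp [(ha k).lattice]
    · simp [(ha k).mono]
    · simp [(ha k).contr x v i hi]
    · refine contr_d_of_transl ((ha k).smooth.const_smul c) ?_ ?_
      · intro x v i hi
        simp [(ha k).contr x v i hi]
      · intro x u hu
        simp [(ha k).transl x u hu]

/-- Shortcut for instance search. -/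
instance basicFormsAddCommGroup : AddCommGroup basicForms := basicForms.addCommGroup

/-! ### The operators `∂` and `∂̄` -/

/-- The tangent vector `u` without its component along the leaf. -/
def hor : Cover →L[ℝ] Cover :=
  (ContinuousLinearMap.fst ℝ (ℂ × ℂ) ℝ).prod 0

/-- The transverse complex structure: multiplication by `i` of the transverse component of `u`. -/
def rot : Cover →L[ℝ] Cover :=
  (Complex.I • ContinuousLinearMap.fst ℝ (ℂ × ℂ) ℝ).prod 0

/-- For `ε = -i` this is `∂α = ∑ dζ_j ∧ ∂α/∂ζ_j` and for `ε = i` it is `∂̄α = ∑ dζ̄_j ∧ ∂α/∂ζ̄_j`, with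
`ζ = (w, z)`: the derivative `D α (u)` in the transverse direction `u` is replaced by its complex linear
part `(D α (u) - i D α (i u)) / 2`, respectively its antilinear part `(D α (u) + i D α (i u)) / 2`, and the
result is alternated as in the exterior derivative. -/
def wirtinger (ε : ℂ) {k : ℕ} (α : KForm k) : KForm (k + 1) := fun x =>
  ContinuousAlternatingMap.alternatizeUncurryFin
    ((1 / 2 : ℂ) • ((fderiv ℝ α x).comp hor + ε • (fderiv ℝ α x).comp rot))

lemma wirtinger_apply (ε : ℂ) {k : ℕ} (α : KForm k) (x : Cover) (v : Fin (k + 1) → Cover) :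
    wirtinger ε α x v = ∑ i : Fin (k + 1), (-1) ^ (i : ℕ) • ((1 / 2 : ℂ) *
      (fderiv ℝ α x (hor (v i)) (i.removeNth v) + ε * fderiv ℝ α x (rot (v i)) (i.removeNth v))) := by
  rw [wirtinger, ContinuousAlternatingMap.alternatizeUncurryFin_apply]
  rfl

lemma IsBasic.wirtinger {k : ℕ} {α : KForm k} (h : IsBasic α) (ε : ℂ) :
    IsBasic (wirtinger ε α) := by
  have hfd : ContDiff ℝ ∞ (fderiv ℝ α) := h.smooth.fderiv_right (by simp)
  have hs : ContDiff ℝ ∞ (TorusSuspension.wirtinger ε α) := by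
    have hL : ContDiff ℝ ∞ (fun L : Cover →L[ℝ] Cover [⋀^Fin k]→L[ℝ] ℂ =>
        ContinuousAlternatingMap.alternatizeUncurryFin L) :=
      IsBoundedLinearMap.contDiff (𝕜 := ℝ) (IsLinearMap.with_bound
        ⟨fun a b => ContinuousAlternatingMap.alternatizeUncurryFin_add a b,
          fun c a => ContinuousAlternatingMap.alternatizeUncurryFin_smul c a⟩ (k + 1)
        fun a => ContinuousAlternatingMap.norm_alternatizeUncurryFin_le a)
    refine hL.comp ?_
    exact ((hfd.clm_comp contDiff_const).add
      ((hfd.clm_comp contDiff_const).const_smul ε)).const_smul (1 / 2 : ℂ)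
  have htr : ∀ u : Cover, (∀ x, α (x + u) = α x) →
      ∀ x, TorusSuspension.wirtinger ε α (x + u) = TorusSuspension.wirtinger ε α x := by
    intro u hu x
    have : fderiv ℝ α (x + u) = fderiv ℝ α x := by
      rw [← fderiv_comp_add_right]
      congr 1
      funext y
      exact hu y
    simp only [TorusSuspension.wirtinger, this]
  have hc : ∀ (x : Cover) (v : Fin (k + 1) → Cover) (i : Fin (k + 1)), (v i).1 = 0 →
      TorusSuspension.wirtinger ε α x v = 0 := by
    intro x v i hi
    rw [wirtinger_apply]
    refine Finset.sum_eq_zero fun j _ => ?_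
    by_cases hj : j = i
    · subst hj
      have h1 : hor (v j) = 0 := by ext <;> simp [hor, hi]
      have h2 : rot (v j) = 0 := by ext <;> simp [rot, hi]
      simp [h1, h2]
    · obtain ⟨l, rfl⟩ := Fin.exists_succAbove_eq (Ne.symm hj)
      rw [fderiv_contr h.smooth h.contr _ _ _ l, fderiv_contr h.smooth h.contr _ _ _ l]
      · simp
      · simpa [Fin.removeNth] using hi
      · simpa [Fin.removeNth] using hi
  refine ⟨hs, fun m n m' n' x => htr _ (h.lattice m n m' n') x, fun x v => ?_, hc,
    contr_d_of_transl hs hc fun x u hu => htr u (fun y => h.transl y u hu) x⟩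
  have key : ∀ (u : Cover) (v : Fin k → Cover),
      fderiv ℝ α (TorusSuspension.mono x) (monoLin u) (fun i => monoLin (v i)) =
        fderiv ℝ α x u v := by
    intro u v
    rw [fderiv_eval h.smooth, fderiv_eval h.smooth]
    have h1 : DifferentiableAt ℝ (fun y => α y fun i => monoLin (v i)) (TorusSuspension.mono x) :=
      (ContinuousAlternatingMap.apply ℝ Cover ℂ
        (fun i => monoLin (v i))).differentiableAt.comp _ (h.smooth.differentiable (by simp) _)
    have h2 : HasFDerivAt TorusSuspension.mono monoLin x := by
      have := monoLin.hasFDerivAt (x := x) |>.add_const ((0, 1) : Cover)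
      refine this.congr_of_eventuallyEq (Filter.Eventually.of_forall fun y => ?_)
      ext <;> simp [TorusSuspension.mono, monoLin]
    have h3 := (h1.hasFDerivAt.comp x h2).fderiv
    have h4 : (fun y => α y v) =
        (fun y => α y fun i => monoLin (v i)) ∘ TorusSuspension.mono := by
      funext y
      exact (h.mono y v).symm
    rw [h4, h3]
    rfl
  have e1 : ∀ u : Cover, hor (monoLin u) = monoLin (hor u) := fun u => by
    ext <;> simp [hor, monoLin, shear]
  have e2 : ∀ u : Cover, rot (monoLin u) = monoLin (rot u) := fun u => by
    ext <;> simp [rot, monoLin, shear, mul_add]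
  rw [wirtinger_apply, wirtinger_apply]
  refine Finset.sum_congr rfl fun i _ => ?_
  have e3 : i.removeNth (fun j => monoLin (v j)) = fun j => monoLin (i.removeNth v j) := rfl
  rw [e1, e2, e3, key, key]

lemma wirtinger_add (ε : ℂ) {k : ℕ} {a b : KForm k} (ha : IsBasic a) (hb : IsBasic b) :
    wirtinger ε (a + b) = wirtinger ε a + wirtinger ε b := by
  funext x
  ext v
  have := fderiv_add (ha.smooth.differentiable (by simp) x) (hb.smooth.differentiable (by simp) x)
  simp only [Pi.add_apply, ContinuousAlternatingMap.add_apply, wirtinger_apply, this,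
    add_apply, ← Finset.sum_add_distrib]
  refine Finset.sum_congr rfl fun i _ => ?_
  rw [← smul_add]
  congr 1
  ring

lemma wirtinger_smul (ε c : ℂ) {k : ℕ} {a : KForm k} (ha : IsBasic a) :
    wirtinger ε (c • a) = c • wirtinger ε a := by
  funext x
  ext v
  have := fderiv_const_smul (ha.smooth.differentiable (by simp) x) c
  simp only [Pi.smul_apply, ContinuousAlternatingMap.smul_apply, wirtinger_apply, this,
    smul_apply, Finset.smul_sum]
  refine Finset.sum_congr rfl fun i _ => ?_
  rw [smul_comm c]
  congr 1
  simp only [smul_eq_mul]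
  ring

/-- `wirtinger`, on all degrees together: it raises the degree by one. -/
def wirtingerRaw (ε : ℂ) (α : RawForm) : RawForm
  | 0 => 0
  | k + 1 => wirtinger ε (α k)

/-- `wirtinger` as an endomorphism of the space of basic forms. -/
def wirtingerBasic (ε : ℂ) : basicForms →ₗ[ℂ] basicForms where
  toFun α := ⟨wirtingerRaw ε α, by
    rintro (_ | k)
    · exact basicForms.zero_mem 0
    · exact (α.2 k).wirtinger ε⟩
  map_add' a b := by
    ext1
    funext k
    rcases k with _ | k
    · exact (add_zero (0 : KForm 0)).symm
    · exact wirtinger_add ε (a.2 k) (b.2 k)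
  map_smul' c a := by
    ext1
    funext k
    rcases k with _ | k
    · exact (smul_zero (A := KForm 0) c).symm
    · exact wirtinger_smul ε c (a.2 k)

/-- `∂` on basic forms. -/
def del : basicForms →ₗ[ℂ] basicForms := wirtingerBasic (-Complex.I)

/-- `∂̄` on basic forms. -/
def delBar : basicForms →ₗ[ℂ] basicForms := wirtingerBasic Complex.I

/-- On basic forms `d = ∂ + ∂̄`. -/
theorem extDeriv_eq_del_add_delBar (α : basicForms) (k : ℕ) :
    extDeriv (α.1 k) = (del α).1 (k + 1) + (delBar α).1 (k + 1) := by
  funext x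
  ext v
  have h : ∀ u, fderiv ℝ (α.1 k) x u = fderiv ℝ (α.1 k) x (hor u) := by
    intro u
    rw [← sub_eq_zero, ← map_sub]
    exact (α.2 k).fderiv_vert _ _ (by simp [hor])
  have e : ((del α).1 (k + 1) + (delBar α).1 (k + 1)) x v =
      wirtinger (-Complex.I) (α.1 k) x v + wirtinger Complex.I (α.1 k) x v := rfl
  rw [e, wirtinger_apply, wirtinger_apply, extDeriv,
    ContinuousAlternatingMap.alternatizeUncurryFin_apply, ← Finset.sum_add_distrib]
  refine Finset.sum_congr rfl fun i _ => ?_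
  rw [← smul_add, h]
  congr 1
  ring

/-! ### Bidegrees and cohomology -/

/-- The basic forms `Ω^{p,q}(M/𝓕, ℂ)` of type `(p,q)` for the transverse complex structure: the forms of
degree `p + q` that are multiplied by `c^p c̄^q` when their transverse arguments are multiplied by `c`. -/
def bidegree (p q : ℕ) : Submodule ℂ basicForms where
  carrier := {α | (∀ k, k ≠ p + q → α.1 k = 0) ∧
    ∀ (k : ℕ) (x : Cover) (c : ℂ) (v : Fin k → Cover),
      α.1 k x (fun i => (c • (v i).1, (v i).2)) = c ^ p * (starRingEnd ℂ c) ^ q * α.1 k x v}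
  add_mem' := by
    rintro a b ⟨ha, ha'⟩ ⟨hb, hb'⟩
    refine ⟨fun k hk => ?_, fun k x c v => ?_⟩
    · simp [ha k hk, hb k hk]
    · simp [ha' k x c v, hb' k x c v, mul_add]
  zero_mem' := ⟨fun k _ => rfl, fun k x c v => by simp⟩
  smul_mem' := by
    rintro r a ⟨ha, ha'⟩
    refine ⟨fun k hk => ?_, fun k x c v => ?_⟩
    · simp [ha k hk]
    · simp [ha' k x c v]
      ring

/-- The quotient `K / (I ∩ K)` of two spaces of basic forms. -/
abbrev QuotBy (K I : Submodule ℂ basicForms) : Type := K ⧸ I.submoduleOf K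

/-- `ker ∂̄ ∩ Ω^{p,q}`. -/
def dolbeaultZ (p q : ℕ) : Submodule ℂ basicForms := LinearMap.ker delBar ⊓ bidegree p q

/-- `im ∂̄ ∩ Ω^{p,q}`. -/
def dolbeaultB (p q : ℕ) : Submodule ℂ basicForms := LinearMap.range delBar ⊓ bidegree p q

/-- Basic Dolbeault cohomology `H^{p,q}_∂̄(M/𝓕)`. -/
abbrev Dolbeault (p q : ℕ) : Type := QuotBy (dolbeaultZ p q) (dolbeaultB p q)

/-- `ker ∂ ∩ ker ∂̄ ∩ Ω^{p,q}`. -/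
def bottChernZ (p q : ℕ) : Submodule ℂ basicForms :=
  LinearMap.ker del ⊓ LinearMap.ker delBar ⊓ bidegree p q

/-- `im ∂∂̄ ∩ Ω^{p,q}`. -/
def bottChernB (p q : ℕ) : Submodule ℂ basicForms := LinearMap.range (del ∘ₗ delBar) ⊓ bidegree p q

/-- Basic Bott-Chern cohomology `H^{p,q}_BC(M/𝓕)`. -/
abbrev BottChern (p q : ℕ) : Type := QuotBy (bottChernZ p q) (bottChernB p q)

/-- `ker ∂∂̄ ∩ Ω^{p,q}`. -/
def aeppliZ (p q : ℕ) : Submodule ℂ basicForms := LinearMap.ker (del ∘ₗ delBar) ⊓ bidegree p q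

/-- `(im ∂ + im ∂̄) ∩ Ω^{p,q}`. -/
def aeppliB (p q : ℕ) : Submodule ℂ basicForms :=
  (LinearMap.range del ⊔ LinearMap.range delBar) ⊓ bidegree p q

/-- Basic Aeppli cohomology `H^{p,q}_A(M/𝓕)`. -/
abbrev Aeppli (p q : ℕ) : Type := QuotBy (aeppliZ p q) (aeppliB p q)

/-! ### The entries of the tables -/

/-- `C^∞(𝕋², ℂ)`: the real-smooth functions of `z ∈ ℂ` that are periodic with respect to `ℤ[i]`. -/
def SmoothT2 : Submodule ℂ (ℂ → ℂ) where
  carrier := {g | ContDiff ℝ ∞ g ∧ ∀ (m n : ℤ) (z : ℂ), g (z + gauss m n) = g z}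
  add_mem' := by
    rintro a b ⟨ha, ha'⟩ ⟨hb, hb'⟩
    exact ⟨ha.add hb, fun m n z => by simp [ha', hb']⟩
  zero_mem' := ⟨contDiff_const, fun _ _ _ => rfl⟩
  smul_mem' := by
    rintro c a ⟨ha, ha'⟩
    exact ⟨ha.const_smul c, fun m n z => by simp [ha']⟩

/-- The 1-form `dw`. -/
def dw : Cover →L[ℝ] ℂ :=
  (ContinuousLinearMap.fst ℝ ℂ ℂ).comp (ContinuousLinearMap.fst ℝ (ℂ × ℂ) ℝ)

/-- The 1-form `dz`. -/
def dz : Cover →L[ℝ] ℂ :=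
  (ContinuousLinearMap.snd ℝ ℂ ℂ).comp (ContinuousLinearMap.fst ℝ (ℂ × ℂ) ℝ)

/-- The 1-form `dw̄`. -/
def dwBar : Cover →L[ℝ] ℂ := (Complex.conjCLE : ℂ →L[ℝ] ℂ).comp dw

/-- The 1-form `dz̄`. -/
def dzBar : Cover →L[ℝ] ℂ := (Complex.conjCLE : ℂ →L[ℝ] ℂ).comp dz

/-- The wedge product `η₁ ∧ ⋯ ∧ η_k` of 1-forms. -/
def wedge {k : ℕ} (η : Fin k → Cover →L[ℝ] ℂ) : Cover [⋀^Fin k]→L[ℝ] ℂ :=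
  ContinuousMultilinearMap.alternatization
    ((ContinuousMultilinearMap.mkPiAlgebra ℝ (Fin k) ℂ).compContinuousLinearMap η)

theorem wedge_apply {k : ℕ} (η : Fin k → Cover →L[ℝ] ℂ) (v : Fin k → Cover) :
    wedge η v = Matrix.det (Matrix.of fun i j => η i (v j)) := by
  rw [wedge, ContinuousMultilinearMap.alternatization_apply_apply, ← Matrix.det_transpose,
    Matrix.det_apply]
  rfl

/-- The form `g(z) η₁ ∧ ⋯ ∧ η_k` (and zero in the degrees other than `k`). -/
def term {k : ℕ} (g : ℂ → ℂ) (η : Fin k → Cover →L[ℝ] ℂ) : RawForm :=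
  Pi.single k fun x => g x.1.2 • wedge η

/-- The form `g(z) (dw ∧ dz̄ + dw̄ ∧ dz)`. -/
def mixed (g : ℂ → ℂ) : RawForm := term g ![dw, dzBar] + term g ![dwBar, dz]

/-- The map that sends `x` to the class of the form `θ x` is a well defined linear isomorphism of `X` onto
the cohomology space `K / (I ∩ K)`. -/
def IsoByClasses {X : Type} [AddCommGroup X] [Module ℂ X] (K I : Submodule ℂ basicForms)
    (θ : X → RawForm) : Prop :=
  ∃ e : X ≃ₗ[ℂ] QuotBy K I, ∀ x : X, ∃ α : K, (α : basicForms).1 = θ x ∧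
    e x = (I.submoduleOf K).mkQ α

/-- `x ↦ [θ x]` is a linear isomorphism of `X` onto `H^{p,q}_∂̄(M/𝓕)`. -/
def DolbeaultVia {X : Type} [AddCommGroup X] [Module ℂ X] (p q : ℕ) (θ : X → RawForm) : Prop :=
  IsoByClasses (dolbeaultZ p q) (dolbeaultB p q) θ

/-- `x ↦ [θ x]` is a linear isomorphism of `X` onto `H^{p,q}_BC(M/𝓕)`. -/
def BottChernVia {X : Type} [AddCommGroup X] [Module ℂ X] (p q : ℕ) (θ : X → RawForm) : Prop :=
  IsoByClasses (bottChernZ p q) (bottChernB p q) θ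

/-- `x ↦ [θ x]` is a linear isomorphism of `X` onto `H^{p,q}_A(M/𝓕)`. -/
def AeppliVia {X : Type} [AddCommGroup X] [Module ℂ X] (p q : ℕ) (θ : X → RawForm) : Prop :=
  IsoByClasses (aeppliZ p q) (aeppliB p q) θ

/-- A Riemannian metric on the transverse torus `𝕋⁴` that is invariant under `A`, that is, under the
holonomy pseudogroup. -/
structure IsTransverseMetric (g : ℂ × ℂ → (ℂ × ℂ) →L[ℝ] (ℂ × ℂ) →L[ℝ] ℝ) : Prop where
  smooth : ContDiff ℝ ∞ g
  symm : ∀ t u v, g t u v = g t v u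
  pos : ∀ t u, u ≠ 0 → 0 < g t u u
  lattice : ∀ (m n m' n' : ℤ) (t : ℂ × ℂ), g (t + (gauss m n, gauss m' n')) = g t
  invariant : ∀ t u v, g (shear t) (shear u) (shear v) = g t u v

end TorusSuspension

end

open TorusSuspension

noncomputable section

namespace TorusSuspension

open MeasureTheory Filter Topology
open scoped ContDiff

/-! ### Fourier series on the torus `ℂ / ℤ[i]` -/

/-! A basic form is a smooth form on `𝕋⁴` invariant under the unipotent map `A`. Such a form turns
out to be a combination of constant invariant forms whose coefficients depend only on `z`, so the
infinite dimensional problem becomes linear algebra over `SmoothT2` together with one analytic fact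
on `𝕋²`.

The reduction has two halves. On the `n`-th iterate of the monodromy the arguments of the form
change by `v ↦ v + n N v` with `N² = 0`, so the value is a polynomial in `n`. It is also bounded,
because a basic form is lattice periodic and constant along the leaves; hence the polynomial is
constant and the form is invariant under the linear part alone (`IsBasic.monoLin_invariant`). What
is left is invariance of the form under `(w, z) ↦ (w + n z, z)`. Near every `z` there are points `y`
for which some multiple `n y` is congruent to any prescribed `u` modulo `ℤ[i]`, so continuity
removes the dependence on `w` (`IsBasic.eq_base`).

The constant invariant forms are spanned by ten explicit ones, and `ofCoords` is a linear bijection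
from ten functions on `𝕋²` to the basic forms (`ofCoords_injective`, `ofCoords_surjective`). In
these coordinates `∂` and `∂̄` are `∂/∂z` and `∂/∂z̄` up to sign, followed by exterior
multiplication with `dz` or `dz̄` (`del_ofCoords`, `delBar_ofCoords`). No derivative in `w` occurs,
so neither operator produces a component along `dw ∧ dz`, `dw̄ ∧ dz̄`, `θ` or the top form, and
`∂∂̄` only sends functions to multiples of `dz ∧ dz̄`. This lack of exact forms is the source of the
infinite dimensional entries.

The analytic fact is that each Wirtinger operator on `𝕋²` has the constants as kernel and the
functions of mean zero as image (`eq_constT2_of_wirtDeriv_eq_zero`, `exists_wirtDeriv_eq`). Fourier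
series prove it: the symbol at a nonzero frequency has modulus at least `1`, so dividing by it
preserves rapid decay. Every table entry then follows from which coefficients are forced to be
constant and which are exact.

Both dualities fail for reasons of dimension: in each pair one space is finite dimensional and the
other is not, which an isomorphism over `ℝ` would also detect. A transverse metric is excluded at
the fixed point `0` by the shear itself. -/

/-- The projection of `ℂ` onto the torus. -/
def torusProj (z : ℂ) : UnitAddTorus (Fin 2) := ![(z.re : UnitAddCircle), (z.im : UnitAddCircle)]

lemma torusProj_add (z w : ℂ) : torusProj (z + w) = torusProj z + torusProj w := by
  ext i
  fin_cases i <;> simp [torusProj]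

/-- A product of the open surjections `ℝ → ℝ/ℤ`. Being a quotient map is what lets continuity
descend from periodic functions to the torus. -/
lemma isQuotientMap_torusProj : IsQuotientMap torusProj := by
  have hc : Continuous torusProj := by
    refine continuous_pi fun i => ?_
    fin_cases i
    · exact (AddCircle.continuous_mk' 1).comp Complex.continuous_re
    · exact (AddCircle.continuous_mk' 1).comp Complex.continuous_im
  have hs : Function.Surjective torusProj := by
    intro t
    obtain ⟨a, ha⟩ := QuotientAddGroup.mk_surjective (t 0)
    obtain ⟨b, hb⟩ := QuotientAddGroup.mk_surjective (t 1)
    refine ⟨⟨a, b⟩, ?_⟩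
    ext i
    fin_cases i
    · exact ha
    · exact hb
  have ho : IsOpenMap torusProj := by
    have h1 : IsOpenMap (Pi.map (fun _ : Fin 2 => ((↑) : ℝ → UnitAddCircle))) :=
      IsOpenMap.piMap (fun _ => QuotientAddGroup.isOpenMap_coe)
        (Filter.Eventually.of_forall fun _ => QuotientAddGroup.mk_surjective)
    have h2 := h1.comp
      (Complex.equivRealProdCLM.toHomeomorph.trans (Homeomorph.finTwoArrow (X := ℝ)).symm).isOpenMap
    convert h2 using 1
    funext z i
    fin_cases i <;> rfl
  exact ho.isQuotientMap hc hs

lemma exists_gauss_of_torusProj_eq {z w : ℂ} (h : torusProj z = torusProj w) :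
    ∃ m n : ℤ, z = w + gauss m n := by
  have h0 : ((z.re - w.re : ℝ) : UnitAddCircle) = 0 := by
    have := congrFun h 0
    simpa [torusProj, sub_eq_zero] using this
  have h1 : ((z.im - w.im : ℝ) : UnitAddCircle) = 0 := by
    have := congrFun h 1
    simpa [torusProj, sub_eq_zero] using this
  obtain ⟨m, hm⟩ := (AddCircle.coe_eq_zero_iff _).1 h0
  obtain ⟨n, hn⟩ := (AddCircle.coe_eq_zero_iff _).1 h1
  refine ⟨m, n, ?_⟩
  apply Complex.ext
  · simp [gauss] at hm ⊢; linarith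
  · simp [gauss] at hn ⊢; linarith

/-- The function on the torus induced by a periodic function. -/
def torusLift (g : ℂ → ℂ) (t : UnitAddTorus (Fin 2)) : ℂ :=
  g (Function.surjInv isQuotientMap_torusProj.surjective t)

/-- Periodicity makes the arbitrary choice of preimage in `torusLift` harmless. -/
lemma torusLift_torusProj (g : SmoothT2) (z : ℂ) : torusLift g.1 (torusProj z) = g.1 z := by
  obtain ⟨m, n, h⟩ := exists_gauss_of_torusProj_eq
    (Function.surjInv_eq isQuotientMap_torusProj.surjective (torusProj z))
  rw [torusLift, h, g.2.2]

lemma continuous_torusLift (g : SmoothT2) : Continuous (torusLift g.1) := by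
  rw [isQuotientMap_torusProj.continuous_iff]
  have : torusLift g.1 ∘ torusProj = g.1 := funext (torusLift_torusProj g)
  rw [this]
  exact g.2.1.continuous

lemma exists_bound_smoothT2 (g : SmoothT2) : ∃ C, ∀ z, ‖g.1 z‖ ≤ C := by
  obtain ⟨C, hC⟩ := (isCompact_range (continuous_torusLift g)).isBounded.exists_norm_le
  exact ⟨C, fun z => torusLift_torusProj g z ▸ hC _ ⟨_, rfl⟩⟩

/-- The derivative in the direction `v`. -/
def dirDeriv (v : ℂ) : SmoothT2 →ₗ[ℂ] SmoothT2 where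
  toFun g := ⟨fun z => fderiv ℝ g.1 z v,
    (g.2.1.fderiv_right (by simp)).clm_apply contDiff_const, fun m n z => by
      change fderiv ℝ g.1 (z + gauss m n) v = fderiv ℝ g.1 z v
      rw [← fderiv_comp_add_right]
      simp only [g.2.2]⟩
  map_add' a b := by
    ext z
    exact congrArg (· v) (fderiv_add (a.2.1.differentiable (by simp) z)
      (b.2.1.differentiable (by simp) z))
  map_smul' c a := by
    ext z
    exact congrArg (· v) (fderiv_const_smul (a.2.1.differentiable (by simp) z) c)

/-- The logarithmic derivative of the character with index `n`. -/
def freq (n : Fin 2 → ℤ) : ℂ →L[ℝ] ℂ :=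
  (2 * Real.pi * Complex.I : ℂ) • (((n 0 : ℤ) : ℂ) • Complex.ofRealCLM.comp Complex.reCLM +
    ((n 1 : ℤ) : ℂ) • Complex.ofRealCLM.comp Complex.imCLM)

lemma freq_apply (n : Fin 2 → ℤ) (z : ℂ) :
    freq n z = 2 * Real.pi * Complex.I * (n 0 * z.re + n 1 * z.im) := rfl

/-- The characters of the torus. -/
def torusChar (n : Fin 2 → ℤ) (z : ℂ) : ℂ := Complex.exp (freq n z)

lemma mFourier_torusProj (n : Fin 2 → ℤ) (z : ℂ) :
    UnitAddTorus.mFourier n (torusProj z) = torusChar n z := by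
  simp only [UnitAddTorus.mFourier, ContinuousMap.coe_mk, Fin.prod_univ_two, torusProj,
    Matrix.cons_val_zero, Matrix.cons_val_one, fourier_coe_apply, torusChar, freq_apply,
    ← Complex.exp_add]
  congr 1
  push_cast
  ring

lemma hasFDerivAt_torusChar (n : Fin 2 → ℤ) (z : ℂ) :
    HasFDerivAt (torusChar n) (torusChar n z • freq n) z :=
  (freq n).hasFDerivAt.cexp

lemma norm_torusChar (n : Fin 2 → ℤ) (z : ℂ) : ‖torusChar n z‖ = 1 := by
  rw [torusChar, Complex.norm_exp, freq_apply]
  simp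

-- Haar measure of total mass one, so that the coefficients below unfold to
-- `UnitAddTorus.mFourierCoeff`.
local instance : MeasureSpace UnitAddCircle := ⟨AddCircle.haarAddCircle⟩

local instance : Measure.IsAddHaarMeasure (volume : Measure UnitAddCircle) :=
  inferInstanceAs (Measure.IsAddHaarMeasure AddCircle.haarAddCircle)

local instance : IsProbabilityMeasure (volume : Measure UnitAddCircle) :=
  inferInstanceAs (IsProbabilityMeasure AddCircle.haarAddCircle)

lemma integrable_mFourier_mul_torusLift (n : Fin 2 → ℤ) (g : SmoothT2) :
    Integrable (fun t => UnitAddTorus.mFourier n t * torusLift g.1 t) :=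
  ((UnitAddTorus.mFourier n).continuous.mul
    (continuous_torusLift g)).integrable_of_hasCompactSupport (HasCompactSupport.of_compactSpace _)

/-- The Fourier coefficients of a periodic function. -/
def fourierCoef (n : Fin 2 → ℤ) : SmoothT2 →ₗ[ℂ] ℂ where
  toFun g := ∫ t, UnitAddTorus.mFourier (-n) t * torusLift g.1 t
  map_add' a b := by
    rw [← integral_add (integrable_mFourier_mul_torusLift _ a)
      (integrable_mFourier_mul_torusLift _ b)]
    refine integral_congr_ae (Eventually.of_forall fun t => ?_)
    exact mul_add _ _ _
  map_smul' c a := by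
    rw [RingHom.id_apply, smul_eq_mul, ← integral_const_mul]
    refine integral_congr_ae (Eventually.of_forall fun t => ?_)
    exact mul_left_comm _ c _

lemma norm_fourierCoef_le (n : Fin 2 → ℤ) (g : SmoothT2) {C : ℝ} (h : ∀ z, ‖g.1 z‖ ≤ C) :
    ‖fourierCoef n g‖ ≤ C := by
  refine (norm_integral_le_of_norm_le_const (C := C) (Eventually.of_forall fun t => ?_)).trans ?_
  · obtain ⟨z, rfl⟩ := isQuotientMap_torusProj.surjective t
    rw [norm_mul, mFourier_torusProj, norm_torusChar, one_mul, torusLift_torusProj]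
    exact h z
  · simp

/-- Translation invariance of Haar measure, with the character absorbing the shift. It replaces
integration by parts in the next lemma. -/
lemma integral_shift (n : Fin 2 → ℤ) (g : SmoothT2) (v : ℂ) :
    ∫ t, UnitAddTorus.mFourier (-n) t * torusLift g.1 (t + torusProj v) =
      torusChar n v * fourierCoef n g := by
  have h : ∀ t, UnitAddTorus.mFourier (-n) t * torusLift g.1 (t + torusProj v) =
      (fun t => torusChar n v * (UnitAddTorus.mFourier (-n) t * torusLift g.1 t))
        (t + torusProj v) := by
    intro t
    obtain ⟨z, rfl⟩ := isQuotientMap_torusProj.surjective t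
    simp only [← torusProj_add, torusLift_torusProj, mFourier_torusProj]
    rw [← mul_assoc, torusChar, torusChar, torusChar, ← Complex.exp_add]
    congr 2
    simp only [freq_apply, Complex.add_re, Complex.add_im, Pi.neg_apply]
    push_cast
    ring
  have h2 := integral_add_right_eq_self (μ := (volume : Measure (UnitAddTorus (Fin 2))))
    (fun t => torusChar n v * (UnitAddTorus.mFourier (-n) t * torusLift g.1 t)) (torusProj v)
  refine (congrArg (integral _) (funext h)).trans (h2.trans ?_)
  exact integral_const_mul _ _

/-- Differentiate `integral_shift` along `s ↦ s • v` at `s = 0`: the left side gives the coefficient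
of the derivative, the right side the logarithmic derivative of the character. -/
lemma fourierCoef_dirDeriv (n : Fin 2 → ℤ) (v : ℂ) (g : SmoothT2) :
    fourierCoef n (dirDeriv v g) = freq n v * fourierCoef n g := by
  obtain ⟨C, hC⟩ := exists_bound_smoothT2 (dirDeriv v g)
  have hF : ∀ h : SmoothT2, ∀ s : ℝ, Continuous fun t =>
      UnitAddTorus.mFourier (-n) t * torusLift h.1 (t + torusProj (s • v)) := fun h s =>
    (UnitAddTorus.mFourier (-n)).continuous.mul
      ((continuous_torusLift h).comp (continuous_add_const _))
  -- Differentiation under the integral; the constant `C` bounds the directional derivative on the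
  -- whole torus, so it dominates for every `s`.
  have key := hasDerivAt_integral_of_dominated_loc_of_deriv_le
    (μ := (volume : Measure (UnitAddTorus (Fin 2)))) (x₀ := (0 : ℝ)) (s := Set.univ)
    (F := fun s t => UnitAddTorus.mFourier (-n) t * torusLift g.1 (t + torusProj (s • v)))
    (F' := fun s t => UnitAddTorus.mFourier (-n) t *
      torusLift (dirDeriv v g).1 (t + torusProj (s • v))) (bound := fun _ => C)
    univ_mem (Eventually.of_forall fun s => (hF g s).aestronglyMeasurable)
    ((hF g 0).integrable_of_hasCompactSupport (HasCompactSupport.of_compactSpace _))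
    (hF _ 0).aestronglyMeasurable
    (Eventually.of_forall fun t s _ => ?_) (integrable_const C)
    (Eventually.of_forall fun t s _ => ?_)
  · have h0 : torusProj ((0 : ℝ) • v) = 0 := by
      ext i
      fin_cases i <;> simp [torusProj]
    have h1 := key.2
    simp only [integral_shift] at h1
    have h2 : HasDerivAt (fun s : ℝ => torusChar n (s • v) * fourierCoef n g)
        (freq n v * fourierCoef n g) 0 := by
      refine HasDerivAt.mul_const ?_ _
      have h3 : HasDerivAt (fun s : ℝ => s • v) v 0 := by
        simpa using (hasDerivAt_id (0 : ℝ)).smul_const v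
      have h4 := (hasFDerivAt_torusChar n ((0 : ℝ) • v)).comp_hasDerivAt (0 : ℝ) h3
      have h5 : torusChar n ((0 : ℝ) • v) = 1 := by simp [torusChar]
      rw [h5] at h4
      simpa [Function.comp_def] using h4
    have h6 := h1.unique h2
    rw [← h6]
    simp [torusChar]
  · obtain ⟨z, rfl⟩ := isQuotientMap_torusProj.surjective t
    rw [norm_mul, mFourier_torusProj, norm_torusChar, one_mul, ← torusProj_add,
      torusLift_torusProj]
    exact hC _
  · obtain ⟨z, rfl⟩ := isQuotientMap_torusProj.surjective t
    simp only [← torusProj_add, torusLift_torusProj]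
    refine HasDerivAt.const_mul _ ?_
    have h3 : HasDerivAt (fun s : ℝ => z + s • v) v s := by
      simpa using ((hasDerivAt_id s).smul_const v).const_add z
    exact ((g.2.1.differentiable (by simp) (z + s • v)).hasFDerivAt).comp_hasDerivAt s h3

lemma hasSum_fourierCoef (g : SmoothT2) (hs : Summable fun n => ‖fourierCoef n g‖) (z : ℂ) :
    HasSum (fun n => fourierCoef n g * torusChar n z) (g.1 z) := by
  have hs' : Summable (UnitAddTorus.mFourierCoeff (⟨_, continuous_torusLift g⟩ :
      C(UnitAddTorus (Fin 2), ℂ))) := Summable.of_norm hs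
  have := UnitAddTorus.hasSum_mFourier_series_apply_of_summable hs' (torusProj z)
  simp only [mFourier_torusProj] at this
  exact torusLift_torusProj g z ▸ this

/-- Constant functions on the torus. -/
def constT2 : ℂ →ₗ[ℂ] SmoothT2 where
  toFun c := ⟨fun _ => c, contDiff_const, fun _ _ _ => rfl⟩
  map_add' _ _ := rfl
  map_smul' _ _ := rfl

lemma constT2_apply (c z : ℂ) : (constT2 c).1 z = c := rfl

/-- The mean of a function on the torus. -/
def meanT2 : SmoothT2 →ₗ[ℂ] ℂ := fourierCoef 0

@[simp] lemma meanT2_constT2 (c : ℂ) : meanT2 (constT2 c) = c := by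
  have : ∀ t, UnitAddTorus.mFourier (-0) t * torusLift (constT2 c).1 t = c := by
    intro t
    simp [UnitAddTorus.mFourier_zero, torusLift, constT2]
  change ∫ t, UnitAddTorus.mFourier (-0) t * torusLift (constT2 c).1 t = c
  simp_rw [this]
  simp

/-! ### Rapidly decaying trigonometric series -/

/-- A family of coefficients that decays faster than every power. -/
def RapidDecay (d : (Fin 2 → ℤ) → ℂ) : Prop := ∀ k : ℕ, Summable fun n => ‖n‖ ^ k * ‖d n‖

/-- The trigonometric series with coefficients `d`. -/
def trigSum (d : (Fin 2 → ℤ) → ℂ) (z : ℂ) : ℂ := ∑' n, d n * torusChar n z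

lemma norm_freq_apply_le (n : Fin 2 → ℤ) (z : ℂ) : ‖freq n z‖ ≤ 4 * Real.pi * ‖n‖ * ‖z‖ := by
  have h0 : ‖((n 0 : ℤ) : ℂ)‖ ≤ ‖n‖ := by simpa [Int.norm_eq_abs] using norm_le_pi_norm n 0
  have h1 : ‖((n 1 : ℤ) : ℂ)‖ ≤ ‖n‖ := by simpa [Int.norm_eq_abs] using norm_le_pi_norm n 1
  have h2 : ‖(z.re : ℂ)‖ ≤ ‖z‖ := by simpa using Complex.abs_re_le_norm z
  have h3 : ‖(z.im : ℂ)‖ ≤ ‖z‖ := by simpa using Complex.abs_im_le_norm z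
  have h4 : ‖(n 0 * z.re + n 1 * z.im : ℂ)‖ ≤ ‖n‖ * ‖z‖ + ‖n‖ * ‖z‖ := by
    refine (norm_add_le _ _).trans (add_le_add ?_ ?_)
    · rw [norm_mul]; gcongr
    · rw [norm_mul]; gcongr
  rw [freq_apply, norm_mul]
  have h5 : ‖(2 * Real.pi * Complex.I : ℂ)‖ = 2 * Real.pi := by
    simp [abs_of_pos Real.pi_pos]
  rw [h5]
  have := mul_le_mul_of_nonneg_left h4 (by positivity : (0 : ℝ) ≤ 2 * Real.pi)
  linarith

lemma RapidDecay.freq_mul {d : (Fin 2 → ℤ) → ℂ} (h : RapidDecay d) (v : ℂ) :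
    RapidDecay fun n => freq n v * d n := by
  intro k
  refine Summable.of_nonneg_of_le (fun n => by positivity) (fun n => ?_)
    ((h (k + 1)).mul_left (4 * Real.pi * ‖v‖))
  rw [norm_mul]
  calc ‖n‖ ^ k * (‖freq n v‖ * ‖d n‖)
      ≤ ‖n‖ ^ k * ((4 * Real.pi * ‖n‖ * ‖v‖) * ‖d n‖) := by
        gcongr; exact norm_freq_apply_le n v
    _ = _ := by ring

lemma RapidDecay.mono {d d' : (Fin 2 → ℤ) → ℂ} (h : RapidDecay d) (h' : ∀ n, ‖d' n‖ ≤ ‖d n‖) :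
    RapidDecay d' := fun k =>
  Summable.of_nonneg_of_le (fun n => by positivity)
    (fun n => mul_le_mul_of_nonneg_left (h' n) (by positivity)) (h k)

lemma RapidDecay.summable {d : (Fin 2 → ℤ) → ℂ} (h : RapidDecay d) (z : ℂ) :
    Summable fun n => d n * torusChar n z := by
  refine Summable.of_norm ?_
  simpa [norm_torusChar] using h 0

/-- Termwise differentiation costs one factor `‖n‖`, so the case `k = 1` of rapid decay gives a
summable bound uniform in `z`. -/
lemma RapidDecay.hasFDerivAt {d : (Fin 2 → ℤ) → ℂ} (h : RapidDecay d) (z : ℂ) :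
    HasFDerivAt (trigSum d) (∑' n, d n • (torusChar n z • freq n)) z ∧
      Summable fun n => d n • (torusChar n z • freq n) := by
  have hu : Summable fun n : Fin 2 → ℤ => 4 * Real.pi * (‖n‖ ^ 1 * ‖d n‖) := (h 1).mul_left _
  have hb : ∀ n z, ‖d n • (torusChar n z • freq n)‖ ≤ 4 * Real.pi * (‖n‖ ^ 1 * ‖d n‖) := by
    intro n z
    rw [norm_smul, norm_smul, norm_torusChar, one_mul, pow_one]
    have : ‖freq n‖ ≤ 4 * Real.pi * ‖n‖ :=
      ContinuousLinearMap.opNorm_le_bound _ (by positivity) (norm_freq_apply_le n)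
    calc ‖d n‖ * ‖freq n‖ ≤ ‖d n‖ * (4 * Real.pi * ‖n‖) := by gcongr
      _ = _ := by ring
  refine ⟨?_, Summable.of_norm_bounded hu fun n => hb n z⟩
  exact hasFDerivAt_tsum hu (fun n z => (hasFDerivAt_torusChar n z).const_mul (d n)) hb
    (h.summable 0) z

lemma RapidDecay.fderiv_apply {d : (Fin 2 → ℤ) → ℂ} (h : RapidDecay d) (z v : ℂ) :
    fderiv ℝ (trigSum d) z v = trigSum (fun n => freq n v * d n) z := by
  rw [(h.hasFDerivAt z).1.fderiv]
  refine ((ContinuousLinearMap.apply ℝ ℂ v).map_tsum (h.hasFDerivAt z).2).trans ?_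
  refine tsum_congr fun n => ?_
  change d n * (torusChar n z * freq n v) = _
  ring

/-- The class of these series is closed under directional derivatives, which drives an induction on
the order of differentiability over all `d` at once. -/
lemma RapidDecay.contDiff {d : (Fin 2 → ℤ) → ℂ} (h : RapidDecay d) : ContDiff ℝ ∞ (trigSum d) := by
  refine contDiff_infty.2 fun k => ?_
  induction k generalizing d with
  | zero =>
    have : Differentiable ℝ (trigSum d) := fun z => (h.hasFDerivAt z).1.differentiableAt
    exact contDiff_zero.2 this.continuous
  | succ k ih =>
    push_cast
    refine contDiff_succ_iff_fderiv.2
      ⟨fun z => (h.hasFDerivAt z).1.differentiableAt, fun h => by simp at h, ?_⟩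
    refine contDiff_clm_apply_iff.2 fun v => ?_
    simp_rw [h.fderiv_apply]
    exact ih (h.freq_mul v)

lemma torusChar_add_gauss (n : Fin 2 → ℤ) (a b : ℤ) (z : ℂ) :
    torusChar n (z + gauss a b) = torusChar n z := by
  rw [← mFourier_torusProj, ← mFourier_torusProj]
  congr 1
  ext i
  fin_cases i <;> simp [torusProj, gauss]

/-- The smooth function with rapidly decaying Fourier coefficients `d`. -/
def RapidDecay.toSmooth {d : (Fin 2 → ℤ) → ℂ} (h : RapidDecay d) : SmoothT2 :=
  ⟨trigSum d, h.contDiff, fun a b z => by simp only [trigSum, torusChar_add_gauss]⟩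

/-! ### Kernel and image of the Wirtinger operators on the torus -/

/-- The operator `(∂_x + ε ∂_y) / 2`: this is `∂/∂z` for `ε = -i` and `∂/∂z̄` for `ε = i`. -/
def wirtDeriv (ε : ℂ) : SmoothT2 →ₗ[ℂ] SmoothT2 :=
  (1 / 2 : ℂ) • (dirDeriv 1 + ε • dirDeriv Complex.I)

lemma wirtDeriv_apply (ε : ℂ) (g : SmoothT2) (z : ℂ) :
    (wirtDeriv ε g).1 z = 1 / 2 * (fderiv ℝ g.1 z 1 + ε * fderiv ℝ g.1 z Complex.I) := rfl

/-- The eigenvalue of `wirtDeriv ε` on the character with index `n`. -/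
def wirtFreq (ε : ℂ) (n : Fin 2 → ℤ) : ℂ := 1 / 2 * (freq n 1 + ε * freq n Complex.I)

lemma wirtFreq_eq (ε : ℂ) (n : Fin 2 → ℤ) : wirtFreq ε n = Real.pi * Complex.I * (n 0 + ε * n 1) := by
  simp [wirtFreq, freq_apply]
  ring

lemma fourierCoef_wirtDeriv (ε : ℂ) (n : Fin 2 → ℤ) (g : SmoothT2) :
    fourierCoef n (wirtDeriv ε g) = wirtFreq ε n * fourierCoef n g := by
  simp only [wirtDeriv, LinearMap.smul_apply, LinearMap.add_apply, map_smul, map_add,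
    fourierCoef_dirDeriv, smul_eq_mul, wirtFreq]
  ring

/-- Ellipticity: for `ε = ±i` the real and imaginary parts of `n₀ + ε n₁` are `n₀` and `±n₁`, so
neither can be cancelled by the other. The factor `π` is larger than `1` and is dropped. -/
lemma norm_le_norm_wirtFreq {ε : ℂ} (hε : ε = Complex.I ∨ ε = -Complex.I) (n : Fin 2 → ℤ) :
    ‖n‖ ≤ ‖wirtFreq ε n‖ := by
  have h : ‖n‖ ≤ ‖(n 0 + ε * n 1 : ℂ)‖ := by
    refine (pi_norm_le_iff_of_nonneg (norm_nonneg _)).2 fun i => ?_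
    fin_cases i
    · have := Complex.abs_re_le_norm (n 0 + ε * n 1 : ℂ)
      rcases hε with rfl | rfl <;> simpa [Int.norm_eq_abs] using this
    · have := Complex.abs_im_le_norm (n 0 + ε * n 1 : ℂ)
      rcases hε with rfl | rfl <;> simpa [Int.norm_eq_abs] using this
  have h5 : ‖(Real.pi * Complex.I : ℂ)‖ = Real.pi := by
    simp [abs_of_pos Real.pi_pos]
  rw [wirtFreq_eq, norm_mul, h5]
  nlinarith [Real.pi_gt_three, norm_nonneg (n 0 + ε * n 1 : ℂ)]

/-- Each application of `∂/∂z̄` multiplies the coefficient by a symbol of size at least `‖n‖`, and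
the result is again a bounded function. -/
lemma exists_pow_mul_fourierCoef_le (g : SmoothT2) (k : ℕ) :
    ∃ C, ∀ n, ‖n‖ ^ k * ‖fourierCoef n g‖ ≤ C := by
  induction k generalizing g with
  | zero =>
    obtain ⟨C, hC⟩ := exists_bound_smoothT2 g
    exact ⟨C, fun n => by simpa using norm_fourierCoef_le n g hC⟩
  | succ k ih =>
    obtain ⟨C, hC⟩ := ih (wirtDeriv Complex.I g)
    refine ⟨C, fun n => le_trans ?_ (hC n)⟩
    rw [fourierCoef_wirtDeriv, norm_mul, pow_succ, mul_assoc]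
    gcongr
    exact norm_le_norm_wirtFreq (Or.inl rfl) n

lemma rapidDecay_fourierCoef (g : SmoothT2) : RapidDecay fun n => fourierCoef n g := by
  intro k
  obtain ⟨C, hC⟩ := exists_pow_mul_fourierCoef_le g (k + 3)
  -- Three extra powers suffice because `‖n‖⁻³` is summable over the rank two lattice.
  have hs := (EisensteinSeries.summable_one_div_norm_rpow (k := 3) (by norm_num)).mul_left C
  refine Summable.of_norm_bounded_eventually hs ?_
  have : ∀ᶠ n : Fin 2 → ℤ in cofinite, n ≠ 0 := by
    rw [eventually_cofinite]
    simp
  filter_upwards [this] with n hn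
  have hn' : 0 < ‖n‖ := norm_pos_iff.2 hn
  rw [norm_mul, norm_norm, norm_pow, norm_norm, Real.rpow_neg hn'.le, ← div_eq_mul_inv,
    le_div_iff₀ (by positivity)]
  have h3 : ‖n‖ ^ (3 : ℝ) = ‖n‖ ^ 3 := by exact_mod_cast Real.rpow_natCast ‖n‖ 3
  rw [h3]
  calc _ = ‖n‖ ^ (k + 3) * ‖fourierCoef n g‖ := by ring
    _ ≤ C := hC n

lemma trigSum_fourierCoef (g : SmoothT2) (z : ℂ) : trigSum (fun n => fourierCoef n g) z = g.1 z := by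
  refine (hasSum_fourierCoef g ?_ z).tsum_eq
  simpa using rapidDecay_fourierCoef g 0

lemma constT2_injective : Function.Injective constT2 :=
  Function.LeftInverse.injective meanT2_constT2

@[simp] lemma wirtDeriv_constT2 (ε c : ℂ) : wirtDeriv ε (constT2 c) = 0 := by
  ext z
  rw [wirtDeriv_apply]
  have : (constT2 c).1 = fun _ => c := rfl
  rw [this]
  simp

@[simp] lemma meanT2_wirtDeriv (ε : ℂ) (g : SmoothT2) : meanT2 (wirtDeriv ε g) = 0 := by
  rw [meanT2, fourierCoef_wirtDeriv, wirtFreq_eq]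
  simp

/-- The symbol is nonzero at every `n ≠ 0`, so only the zeroth term of the Fourier series survives.
-/
lemma eq_constT2_of_wirtDeriv_eq_zero {ε : ℂ} (hε : ε = Complex.I ∨ ε = -Complex.I) {g : SmoothT2}
    (h : wirtDeriv ε g = 0) : g = constT2 (meanT2 g) := by
  ext z
  rw [← trigSum_fourierCoef, trigSum, tsum_eq_single 0]
  · simp [torusChar, freq_apply, meanT2, constT2_apply]
  · intro n hn
    have h1 := fourierCoef_wirtDeriv ε n g
    rw [h, map_zero] at h1
    have h2 : wirtFreq ε n ≠ 0 := by
      rw [← norm_pos_iff]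
      exact (norm_pos_iff.2 hn).trans_le (norm_le_norm_wirtFreq hε n)
    rw [(mul_eq_zero.1 h1.symm).resolve_left h2, zero_mul]

/-- Divide the coefficients by the symbol; there are no small divisors, so rapid decay survives. The
normalization of `f` allows the lemma to be applied again to `f`, as is needed for `∂∂̄`. -/
lemma exists_wirtDeriv_eq {ε : ℂ} (hε : ε = Complex.I ∨ ε = -Complex.I) {g : SmoothT2}
    (h : meanT2 g = 0) : ∃ f, wirtDeriv ε f = g ∧ meanT2 f = 0 := by
  have hne : ∀ n ≠ 0, 1 ≤ ‖wirtFreq ε n‖ := by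
    intro n hn
    refine le_trans ?_ (norm_le_norm_wirtFreq hε n)
    obtain ⟨i, hi⟩ := Function.ne_iff.1 hn
    refine le_trans ?_ (norm_le_pi_norm n i)
    rw [Int.norm_eq_abs]
    exact_mod_cast Int.one_le_abs hi
  have hd : RapidDecay fun n => (wirtFreq ε n)⁻¹ * fourierCoef n g := by
    refine (rapidDecay_fourierCoef g).mono fun n => ?_
    -- At `n = 0` the symbol vanishes and its inverse is `0` by convention, so the bound is trivial
    -- there.
    by_cases hn : n = 0
    · subst hn
      rw [wirtFreq_eq]
      simp
    · rw [norm_mul, norm_inv]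
      exact mul_le_of_le_one_left (norm_nonneg _) (inv_le_one_of_one_le₀ (hne n hn))
  have hf : wirtDeriv ε hd.toSmooth = g := by
    ext z
    rw [wirtDeriv_apply, ← trigSum_fourierCoef]
    change 1 / 2 * (fderiv ℝ (trigSum _) z 1 + ε * fderiv ℝ (trigSum _) z Complex.I) = _
    rw [hd.fderiv_apply, hd.fderiv_apply, trigSum, trigSum, ← tsum_mul_left,
      ← ((hd.freq_mul 1).summable z).tsum_add (((hd.freq_mul _).summable z).mul_left ε),
      ← tsum_mul_left]
    refine tsum_congr fun n => ?_
    have : 1 / 2 * (freq n 1 * ((wirtFreq ε n)⁻¹ * fourierCoef n g) * torusChar n z +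
        ε * (freq n Complex.I * ((wirtFreq ε n)⁻¹ * fourierCoef n g) * torusChar n z)) =
        wirtFreq ε n * (wirtFreq ε n)⁻¹ * (fourierCoef n g * torusChar n z) := by
      rw [wirtFreq]
      ring
    rw [this]
    by_cases hn : n = 0
    · subst hn
      have : fourierCoef 0 g = 0 := h
      simp [this]
    · rw [mul_inv_cancel₀, one_mul]
      rw [← norm_pos_iff]
      exact one_pos.trans_le (hne n hn)
  -- Subtracting the mean does not affect the derivative.
  refine ⟨hd.toSmooth - constT2 (meanT2 hd.toSmooth), ?_, ?_⟩
  · rw [map_sub, hf, wirtDeriv_constT2, sub_zero]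
  · rw [map_sub, meanT2_constT2, sub_self]

/-! ### Basic forms only depend on `z` -/

lemma exists_gauss_norm_sub_le (z : ℂ) : ∃ m n : ℤ, ‖z - gauss m n‖ ≤ 2 := by
  refine ⟨⌊z.re⌋, ⌊z.im⌋, (Complex.norm_le_abs_re_add_abs_im _).trans ?_⟩
  have h1 : |(z - gauss ⌊z.re⌋ ⌊z.im⌋).re| ≤ 1 := by
    have : (z - gauss ⌊z.re⌋ ⌊z.im⌋).re = Int.fract z.re := by
      simp [gauss, Int.self_sub_floor]
    rw [this, abs_of_nonneg (Int.fract_nonneg _)]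
    exact (Int.fract_lt_one _).le
  have h2 : |(z - gauss ⌊z.re⌋ ⌊z.im⌋).im| ≤ 1 := by
    have : (z - gauss ⌊z.re⌋ ⌊z.im⌋).im = Int.fract z.im := by
      simp [gauss, Int.self_sub_floor]
    rw [this, abs_of_nonneg (Int.fract_nonneg _)]
    exact (Int.fract_lt_one _).le
  linarith

lemma gauss_neg (m n : ℤ) : gauss (-m) (-n) = -gauss m n := by
  simp [gauss]; ring

lemma gauss_zero : gauss 0 0 = 0 := by simp [gauss]

/-- Constancy along the leaves removes `s` and the lattice brings `(w, z)` into a bounded set, so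
all values of `α` are attained on one compact ball. -/
lemma IsBasic.exists_bound {k : ℕ} {α : KForm k} (h : IsBasic α) : ∃ C, ∀ x, ‖α x‖ ≤ C := by
  obtain ⟨C, hC⟩ := ((isCompact_closedBall (0 : Cover) 2).image
    h.smooth.continuous).isBounded.exists_norm_le
  refine ⟨C, fun x => ?_⟩
  obtain ⟨m, n, h1⟩ := exists_gauss_norm_sub_le x.1.1
  obtain ⟨m', n', h2⟩ := exists_gauss_norm_sub_le x.1.2
  have e : α x = α ((x.1.1 - gauss m n, x.1.2 - gauss m' n'), 0) := by
    rw [← h.lattice m n m' n' ((x.1.1 - gauss m n, x.1.2 - gauss m' n'), 0),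
      ← h.transl (_ + _) ((0, 0), x.2) rfl]
    congr 1
    ext <;> simp
  rw [e]
  refine hC _ ⟨_, ?_, rfl⟩
  rw [mem_closedBall_zero_iff]
  simp [Prod.norm_def, h1, h2]

/-- The nilpotent part of `monoLin`. -/
def monoNil (u : Cover) : Cover := ((u.1.2, 0), 0)

lemma monoLin_eq (u : Cover) : monoLin u = u + monoNil u := by
  ext <;> simp [monoLin, shear, monoNil]

/-- Invariance under the `n`-th power of the monodromy. Its linear part is affine in `n` because
`monoNil` squares to zero. -/
lemma IsBasic.iterate {k : ℕ} {α : KForm k} (h : IsBasic α) (n : ℕ) (w z : ℂ) (s : ℝ)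
    (v : Fin k → Cover) :
    α ((w + n * z, z), s + n) (fun i => v i + (n : ℝ) • monoNil (v i)) = α ((w, z), s) v := by
  induction n with
  | zero => simp
  | succ n ih =>
    rw [← ih, ← h.mono ((w + n * z, z), s + n)]
    congr 2
    · ext <;> simp [TorusSuspension.mono, shear]
      all_goals ring
    · funext i
      ext <;> simp [monoLin_eq, monoNil]
      ring

/-- A polynomial that is bounded on the natural numbers is constant. -/
lemma eval_eq_of_bounded {p : Polynomial ℂ} {C : ℝ} (h : ∀ n : ℕ, ‖p.eval (n : ℂ)‖ ≤ C) (a b : ℂ) :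
    p.eval a = p.eval b := by
  by_cases hp : 0 < p.degree
  · have ht : Tendsto (fun n : ℕ => ‖(n : ℂ)‖) atTop atTop := by
      simpa using tendsto_natCast_atTop_atTop (R := ℝ)
    have := p.tendsto_norm_atTop hp ht
    obtain ⟨n, hn⟩ := (this.eventually (eventually_gt_atTop C)).exists
    exact absurd (h n) (not_le.2 hn)
  · rw [Polynomial.eq_C_of_degree_le_zero (not_lt.1 hp)]
    simp

/-- Multilinear expansion over the set `s` of slots that receive `n u` instead of `v`; such a term
carries `n ^ s.card`. -/
lemma exists_polynomial_eval {k : ℕ} (a : Cover [⋀^Fin k]→L[ℝ] ℂ) (v u : Fin k → Cover) :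
    ∃ p : Polynomial ℂ, ∀ n : ℕ, p.eval (n : ℂ) = a (fun i => v i + (n : ℝ) • u i) := by
  classical
  refine ⟨∑ s : Finset (Fin k), Polynomial.C (a (s.piecewise u v)) * Polynomial.X ^ s.card,
    fun n => ?_⟩
  have h1 : (fun i => v i + (n : ℝ) • u i) = (fun i => (n : ℝ) • u i) + v :=
    funext fun i => add_comm _ _
  have h2 := a.toMultilinearMap.map_add_univ (fun i => (n : ℝ) • u i) v
  rw [h1]
  refine Eq.trans ?_ h2.symm
  rw [Polynomial.eval_finsetSum]
  refine Finset.sum_congr rfl fun s _ => ?_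
  have h3 := a.toMultilinearMap.map_piecewise_smul (fun _ => (n : ℝ)) (s.piecewise u v) s
  have h4 : s.piecewise (fun i => (n : ℝ) • s.piecewise u v i) (s.piecewise u v) =
      s.piecewise (fun i => (n : ℝ) • u i) v := by
    funext i
    by_cases hi : i ∈ s <;> simp [hi]
  rw [h4] at h3
  rw [h3]
  simp
  exact mul_comm _ _

/-- The values of `α x` on `v + n N v` form a polynomial in `n` that is bounded by `C ∏ ‖v i‖`,
hence a constant one. This separates the action on tangent vectors from the action on points. -/
lemma IsBasic.monoLin_invariant {k : ℕ} {α : KForm k} (h : IsBasic α) (x : Cover)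
    (v : Fin k → Cover) : α x (fun i => monoLin (v i)) = α x v := by
  obtain ⟨C, hC⟩ := h.exists_bound
  obtain ⟨p, hp⟩ := exists_polynomial_eval (α x) v (fun i => monoNil (v i))
  have hb : ∀ n : ℕ, ‖p.eval (n : ℂ)‖ ≤ C * ∏ i, ‖v i‖ := by
    intro n
    -- The base point is pulled back `n` times so that the iterate lands at the fixed point of
    -- evaluation `x`.
    have := h.iterate n (x.1.1 - n * x.1.2) x.1.2 (x.2 - n) v
    simp only [sub_add_cancel] at this
    rw [hp, this]
    refine ((α _).le_opNorm v).trans ?_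
    gcongr
    exact hC _
  -- The value at `1` is `α x` on the vectors moved by `monoLin`, the value at `0` is `α x v`.
  have := eval_eq_of_bounded hb (1 : ℕ) (0 : ℕ)
  rw [hp, hp] at this
  simpa [monoLin_eq] using this

lemma IsBasic.add_mul {k : ℕ} {α : KForm k} (h : IsBasic α) (n : ℕ) (w z : ℂ) :
    α ((w + n * z, z), 0) = α ((w, z), 0) := by
  induction n with
  | zero => simp
  | succ n ih =>
    rw [← ih]
    ext v
    rw [← h.mono ((w + n * z, z), 0), h.monoLin_invariant,
      ← h.transl ((w + (n + 1 : ℕ) * z, z), 0) ((0, 0), 1) rfl]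
    congr 2
    ext <;> simp [TorusSuspension.mono, shear]
    ring

/-- On a fibre over `y` with `n y ≡ u` modulo `ℤ[i]`, the points `0` and `u` are identified by
`add_mul` and the lattice. Such `y` accumulate at every `z`, and `α` is continuous. -/
lemma IsBasic.eq_base {k : ℕ} {α : KForm k} (h : IsBasic α) (x : Cover) :
    α x = α ((0, x.1.2), 0) := by
  obtain ⟨⟨u, z⟩, s⟩ := x
  have h0 : α ((u, z), s) = α ((u, z), 0) := by
    rw [← h.transl ((u, z), 0) ((0, 0), s) rfl]
    congr 1
    ext <;> simp
  rw [h0]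
  -- Rounding `(k + 1) z - u` to a Gaussian integer gives `y k` with `(k + 1) y k` congruent to `u`
  -- and at distance at most `2 / (k + 1)` from `z`. The index `k + 1` avoids division by zero.
  choose m n hmn using fun k : ℕ => exists_gauss_norm_sub_le ((k + 1 : ℕ) * z - u)
  set y : ℕ → ℂ := fun k => (u + gauss (m k) (n k)) / (k + 1 : ℕ) with hy
  have hlim : Tendsto y atTop (𝓝 z) := by
    rw [tendsto_iff_norm_sub_tendsto_zero]
    have h1 : Tendsto (fun k : ℕ => 2 * (1 / ((k : ℝ) + 1))) atTop (𝓝 0) := by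
      simpa using tendsto_one_div_add_atTop_nhds_zero_nat.const_mul (2 : ℝ)
    refine squeeze_zero (fun _ => norm_nonneg _) (fun k => ?_) h1
    have hk : ((k + 1 : ℕ) : ℂ) ≠ 0 := by exact_mod_cast k.succ_ne_zero
    have e : y k - z = -(((k + 1 : ℕ) * z - u) - gauss (m k) (n k)) / (k + 1 : ℕ) := by
      simp only [hy]
      field_simp
      ring
    rw [e, norm_div, norm_neg, Complex.norm_natCast, ← div_eq_mul_one_div]
    have := hmn k
    push_cast at this ⊢
    gcongr
  have hc : ∀ w : ℂ, Tendsto (fun k => α ((w, y k), 0)) atTop (𝓝 (α ((w, z), 0))) := by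
    intro w
    have : Continuous fun z : ℂ => α ((w, z), 0) :=
      h.smooth.continuous.comp (by fun_prop)
    exact (this.tendsto z).comp hlim
  refine tendsto_nhds_unique (hc u) ((hc 0).congr fun k => ?_)
  have hk : ((k + 1 : ℕ) : ℂ) ≠ 0 := by exact_mod_cast k.succ_ne_zero
  rw [← h.add_mul (k + 1), ← h.lattice (-m k) (-n k) 0 0]
  congr 1
  rw [gauss_neg, gauss_zero]
  have : 0 + ((k + 1 : ℕ) : ℂ) * y k = u + gauss (m k) (n k) := by
    simp only [hy]
    field_simp
    ring
  rw [this]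
  ext <;> simp

/-! ### Forms `g(z) a` with a constant form `a` -/

/-- A constant form on the transversal that is invariant under the monodromy. -/
structure IsInvariant {k : ℕ} (a : Cover [⋀^Fin k]→L[ℝ] ℂ) : Prop where
  vert : ∀ (v : Fin k → Cover) (i : Fin k), (v i).1 = 0 → a v = 0
  inv : ∀ v : Fin k → Cover, a (fun i => monoLin (v i)) = a v

/-- The form `g(z) a`. -/
def scaled {k : ℕ} (g : ℂ → ℂ) (a : Cover [⋀^Fin k]→L[ℝ] ℂ) : KForm k := fun x => g x.1.2 • a

lemma scaled_apply {k : ℕ} (g : ℂ → ℂ) (a : Cover [⋀^Fin k]→L[ℝ] ℂ) (x : Cover)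
    (v : Fin k → Cover) : scaled g a x v = g x.1.2 * a v := rfl

lemma contDiff_scaled {k : ℕ} (g : SmoothT2) (a : Cover [⋀^Fin k]→L[ℝ] ℂ) :
    ContDiff ℝ ∞ (scaled g.1 a) :=
  (g.2.1.comp (contDiff_snd.comp contDiff_fst)).smul contDiff_const

lemma IsInvariant.isBasic {k : ℕ} {a : Cover [⋀^Fin k]→L[ℝ] ℂ} (ha : IsInvariant a)
    (g : SmoothT2) : IsBasic (scaled g.1 a) := by
  have hc : ∀ (x : Cover) (v : Fin k → Cover) (i : Fin k), (v i).1 = 0 → scaled g.1 a x v = 0 :=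
    fun x v i hi => by rw [scaled_apply, ha.vert v i hi, mul_zero]
  refine ⟨contDiff_scaled g a, fun m n m' n' x => ?_, fun x v => ?_, hc,
    contr_d_of_transl (contDiff_scaled g a) hc fun x u hu => ?_⟩
  · simp [scaled, g.2.2]
  · rw [scaled_apply, scaled_apply, ha.inv]
    simp [TorusSuspension.mono, shear]
  · simp [scaled, hu]

/-- The 1-form `dx - ε dy` in the coordinate `z = x + i y`: this is `dz` for `ε = -i` and `dz̄` for
`ε = i`. -/
def wirtCovector (ε : ℂ) : Cover →L[ℝ] ℂ :=
  (Complex.ofRealCLM.comp Complex.reCLM - ε • Complex.ofRealCLM.comp Complex.imCLM).comp dz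

lemma wirtCovector_apply (ε : ℂ) (u : Cover) :
    wirtCovector ε u = u.1.2.re - ε * u.1.2.im := rfl

lemma dzBar_apply (u : Cover) : dzBar u = starRingEnd ℂ u.1.2 := rfl

lemma dwBar_apply (u : Cover) : dwBar u = starRingEnd ℂ u.1.1 := rfl

lemma dz_apply (u : Cover) : dz u = u.1.2 := rfl

lemma dw_apply (u : Cover) : dw u = u.1.1 := rfl

lemma wirtCovector_I : wirtCovector Complex.I = dzBar :=
  ContinuousLinearMap.ext fun u => by
    rw [wirtCovector_apply, dzBar_apply]
    apply Complex.ext <;> simp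

lemma wirtCovector_neg_I : wirtCovector (-Complex.I) = dz :=
  ContinuousLinearMap.ext fun u => by
    rw [wirtCovector_apply, dz_apply]
    apply Complex.ext <;> simp

/-- The exterior product of a covector with an alternating form. -/
def wedgeLeft {k : ℕ} (b : Cover →L[ℝ] ℂ) (a : Cover [⋀^Fin k]→L[ℝ] ℂ) :
    Cover [⋀^Fin (k + 1)]→L[ℝ] ℂ :=
  ContinuousAlternatingMap.alternatizeUncurryFin (b.smulRight a)

lemma wedgeLeft_apply {k : ℕ} (b : Cover →L[ℝ] ℂ) (a : Cover [⋀^Fin k]→L[ℝ] ℂ)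
    (v : Fin (k + 1) → Cover) :
    wedgeLeft b a v = ∑ i : Fin (k + 1), (-1) ^ (i : ℕ) * (b (v i) * a (i.removeNth v)) := by
  rw [wedgeLeft, ContinuousAlternatingMap.alternatizeUncurryFin_apply]
  refine Finset.sum_congr rfl fun i _ => ?_
  rw [zsmul_eq_mul]
  push_cast
  rfl

lemma wedgeLeft_add {k : ℕ} (b : Cover →L[ℝ] ℂ) (a a' : Cover [⋀^Fin k]→L[ℝ] ℂ) :
    wedgeLeft b (a + a') = wedgeLeft b a + wedgeLeft b a' := by
  ext v
  simp only [wedgeLeft_apply, ContinuousAlternatingMap.add_apply, ← Finset.sum_add_distrib]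
  refine Finset.sum_congr rfl fun i _ => ?_
  ring

/-- Laplace expansion of the determinant along its first row. -/
lemma wedgeLeft_wedge {k : ℕ} (b : Cover →L[ℝ] ℂ) (η : Fin k → Cover →L[ℝ] ℂ) :
    wedgeLeft b (wedge η) = wedge (Matrix.vecCons b η) := by
  ext v
  rw [wedgeLeft_apply, wedge_apply, Matrix.det_succ_row_zero]
  refine Finset.sum_congr rfl fun i _ => ?_
  rw [wedge_apply, mul_assoc]
  rfl

/-- Leibniz rule with a constant factor `a`. The coefficient depends only on `z`, so the sole
covector that appears is `dz` or `dz̄`; the factorization into derivative and covector uses just `ε²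
= -1`. -/
lemma wirtinger_scaled {ε : ℂ} (hε : ε = Complex.I ∨ ε = -Complex.I) {k : ℕ} (g : SmoothT2)
    (a : Cover [⋀^Fin k]→L[ℝ] ℂ) :
    wirtinger ε (scaled g.1 a) = scaled (wirtDeriv ε g).1 (wedgeLeft (wirtCovector ε) a) := by
  have hε2 : ε * ε = -1 := by rcases hε with rfl | rfl <;> simp
  funext x
  ext v
  have hd : ∀ u v, fderiv ℝ (scaled g.1 a) x u v = fderiv ℝ g.1 x.1.2 u.1.2 * a v := by
    intro u v
    rw [fderiv_eval (contDiff_scaled g a)]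
    simp only [scaled_apply]
    have h1 : HasFDerivAt (fun y : Cover => g.1 y.1.2 * a v) _ x :=
      (((g.2.1.differentiable (by simp) _).hasFDerivAt.comp x
        ((hasFDerivAt_snd (𝕜 := ℝ) (E := ℂ) (F := ℂ)).comp x
          (hasFDerivAt_fst (𝕜 := ℝ) (E := ℂ × ℂ) (F := ℝ)))).mul_const (a v))
    rw [h1.fderiv]
    exact mul_comm _ _
  have hl : ∀ z : ℂ, fderiv ℝ g.1 x.1.2 z = z.re * fderiv ℝ g.1 x.1.2 1 +
      z.im * fderiv ℝ g.1 x.1.2 Complex.I := by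
    intro z
    have : z = z.re • (1 : ℂ) + z.im • Complex.I := by simp
    conv_lhs => rw [this, map_add, map_smul, map_smul]
    simp
  rw [wirtinger_apply, scaled_apply, wedgeLeft_apply, Finset.mul_sum]
  refine Finset.sum_congr rfl fun i _ => ?_
  rw [hd, hd, wirtCovector_apply, wirtDeriv_apply, hl (hor (v i)).1.2, hl (rot (v i)).1.2]
  have e1 : (hor (v i)).1.2 = (v i).1.2 := rfl
  have e2 : (rot (v i)).1.2 = Complex.I * (v i).1.2 := rfl
  rw [e1, e2, zsmul_eq_mul]
  simp only [Complex.mul_re, Complex.mul_im, Complex.I_re, Complex.I_im]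
  push_cast
  linear_combination ((-1) ^ (i : ℕ) * (1 / 2) * (fderiv ℝ g.1 x.1.2 Complex.I) * (v i).1.2.im *
    a (i.removeNth v)) * hε2

/-! ### Invariant constant forms -/

/-- The real coordinate vectors `∂/∂x₁, ∂/∂y₁, ∂/∂x₂, ∂/∂y₂`. -/
def frame : Fin 4 → Cover :=
  ![((1, 0), 0), ((Complex.I, 0), 0), ((0, 1), 0), ((0, Complex.I), 0)]

/-- A basis of the cover that consists of `frame` and the leaf direction. -/
def coverBasis : Module.Basis (Fin 4 ⊕ Unit) ℝ Cover :=
  (((Complex.basisOneI.prod Complex.basisOneI).reindex finSumFinEquiv).prod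
    (Module.Basis.singleton Unit ℝ))

lemma coverBasis_inl (i : Fin 4) : coverBasis (Sum.inl i) = frame i := by
  have h0 : (finSumFinEquiv (m := 2) (n := 2)).symm 0 = Sum.inl 0 := rfl
  have h1 : (finSumFinEquiv (m := 2) (n := 2)).symm 1 = Sum.inl 1 := rfl
  have h2 : (finSumFinEquiv (m := 2) (n := 2)).symm 2 = Sum.inr 0 := rfl
  have h3 : (finSumFinEquiv (m := 2) (n := 2)).symm 3 = Sum.inr 1 := rfl
  fin_cases i <;> simp [coverBasis, frame, h0, h1, h2, h3]

lemma coverBasis_inr (i : Unit) : (coverBasis (Sum.inr i)).1 = 0 := by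
  simp [coverBasis]

/-- Forms that vanish on the leaf direction agree if they agree on increasing tuples of coordinate
vectors. -/
lemma ext_strictMono {k : ℕ} {a b : Cover [⋀^Fin k]→L[ℝ] ℂ} (ha : IsInvariant a)
    (hb : IsInvariant b)
    (h : ∀ v : Fin k → Fin 4, StrictMono v → a (fun i => frame (v i)) = b (fun i => frame (v i))) :
    a = b := by
  apply ContinuousAlternatingMap.toAlternatingMap_injective
  refine Module.Basis.ext_alternating coverBasis fun v hv => ?_
  by_cases hr : ∃ i j, v i = Sum.inr j
  · obtain ⟨i, j, hij⟩ := hr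
    have hi : (coverBasis (v i)).1 = 0 := by rw [hij, coverBasis_inr]
    exact (ha.vert _ i hi).trans (hb.vert _ i hi).symm
  · have hl : ∀ i, ∃ j, v i = Sum.inl j := by
      intro i
      rcases hvi : v i with j | j
      · exact ⟨j, rfl⟩
      · exact absurd ⟨i, j, hvi⟩ hr
    choose w hw using hl
    have hwi : Function.Injective w := fun i j hij => hv (by rw [hw, hw, hij])
    have hs : StrictMono (w ∘ Tuple.sort w) :=
      (Tuple.monotone_sort w).strictMono_of_injective (hwi.comp (Tuple.sort w).injective)
    have e := h _ hs
    -- Sorting the tuple changes both forms by the same sign, which is cancelled at the end.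
    have e1 := a.toAlternatingMap.map_perm (fun i => frame (w i)) (Tuple.sort w)
    have e2 := b.toAlternatingMap.map_perm (fun i => frame (w i)) (Tuple.sort w)
    have e3 := (e1.symm.trans e).trans e2
    have e4 : (fun i => coverBasis (v i)) = fun i => frame (w i) := by
      funext i
      rw [hw, coverBasis_inl]
    rw [e4]
    exact smul_left_cancel _ e3

lemma eq_zero_of_five_le {k : ℕ} (hk : 5 ≤ k) {a : Cover [⋀^Fin k]→L[ℝ] ℂ} (ha : IsInvariant a) :
    a = 0 := by
  refine ext_strictMono ha ⟨fun _ _ _ => rfl, fun _ => rfl⟩ fun v hv => ?_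
  have := Fintype.card_le_of_injective v hv.injective
  simp at this
  omega

lemma IsBasic.isInvariant {k : ℕ} {α : KForm k} (h : IsBasic α) (x : Cover) : IsInvariant (α x) :=
  ⟨h.contr x, h.monoLin_invariant x⟩

lemma wedge_vert {k : ℕ} {η : Fin k → Cover →L[ℝ] ℂ} (h : ∀ i u, u.1 = 0 → η i u = 0)
    (v : Fin k → Cover) (i : Fin k) (hi : (v i).1 = 0) : wedge η v = 0 := by
  rw [wedge_apply]
  exact Matrix.det_eq_zero_of_column_eq_zero i fun j => h j _ hi

lemma dw_vert (u : Cover) (hu : u.1 = 0) : dw u = 0 := by simp [dw_apply, hu]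
lemma dz_vert (u : Cover) (hu : u.1 = 0) : dz u = 0 := by simp [dz_apply, hu]
lemma dwBar_vert (u : Cover) (hu : u.1 = 0) : dwBar u = 0 := by simp [dwBar_apply, hu]
lemma dzBar_vert (u : Cover) (hu : u.1 = 0) : dzBar u = 0 := by simp [dzBar_apply, hu]

/-- Pullback adds `dz` to `dw` and `dz̄` to `dw̄`. A product is therefore invariant when each added
term repeats a factor, as happens in the products with `dw` or `dw̄` below. -/
lemma dw_monoLin (u : Cover) : dw (monoLin u) = dw u + dz u := rfl
lemma dz_monoLin (u : Cover) : dz (monoLin u) = dz u := rfl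
lemma dwBar_monoLin (u : Cover) : dwBar (monoLin u) = dwBar u + dzBar u :=
  map_add (starRingEnd ℂ) _ _
lemma dzBar_monoLin (u : Cover) : dzBar (monoLin u) = dzBar u := rfl

/-- The constant form `dw ∧ dz̄ + dw̄ ∧ dz`. -/
def thetaForm : Cover [⋀^Fin 2]→L[ℝ] ℂ := wedge ![dw, dzBar] + wedge ![dwBar, dz]

lemma isInvariant_one : IsInvariant (wedge ![]) :=
  ⟨fun v i => i.elim0, fun v => by simp [wedge_apply]⟩

lemma isInvariant_dz : IsInvariant (wedge ![dz]) :=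
  ⟨wedge_vert (by intro i; fin_cases i; exact dz_vert), fun v => by simp [wedge_apply, dz_monoLin]⟩

lemma isInvariant_dzBar : IsInvariant (wedge ![dzBar]) :=
  ⟨wedge_vert (by intro i; fin_cases i; exact dzBar_vert), fun v => by
    simp [wedge_apply, dzBar_monoLin]⟩

lemma isInvariant_dw_dz : IsInvariant (wedge ![dw, dz]) :=
  ⟨wedge_vert (by intro i; fin_cases i <;> [exact dw_vert; exact dz_vert]), fun v => by
    simp [wedge_apply, Matrix.det_fin_two, dw_monoLin, dz_monoLin]; ring⟩

lemma isInvariant_dwBar_dzBar : IsInvariant (wedge ![dwBar, dzBar]) :=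
  ⟨wedge_vert (by intro i; fin_cases i <;> [exact dwBar_vert; exact dzBar_vert]), fun v => by
    simp [wedge_apply, Matrix.det_fin_two, dwBar_monoLin, dzBar_monoLin]; ring⟩

lemma isInvariant_dz_dzBar : IsInvariant (wedge ![dz, dzBar]) :=
  ⟨wedge_vert (by intro i; fin_cases i <;> [exact dz_vert; exact dzBar_vert]), fun v => by
    simp [wedge_apply, Matrix.det_fin_two, dz_monoLin, dzBar_monoLin]⟩

/-- Neither summand is invariant: they gain `dz ∧ dz̄` and `dz̄ ∧ dz`, which cancel in the sum. -/
lemma isInvariant_thetaForm : IsInvariant thetaForm := by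
  refine ⟨fun v i hi => ?_, fun v => ?_⟩
  · rw [thetaForm, ContinuousAlternatingMap.add_apply,
      wedge_vert (by intro i; fin_cases i <;> [exact dw_vert; exact dzBar_vert]) v i hi,
      wedge_vert (by intro i; fin_cases i <;> [exact dwBar_vert; exact dz_vert]) v i hi, add_zero]
  · simp [thetaForm, wedge_apply, Matrix.det_fin_two, dw_monoLin, dz_monoLin, dwBar_monoLin,
      dzBar_monoLin]
    ring

lemma isInvariant_dw_dz_dzBar : IsInvariant (wedge ![dw, dz, dzBar]) :=
  ⟨wedge_vert (by intro i; fin_cases i <;> [exact dw_vert; exact dz_vert; exact dzBar_vert]),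
    fun v => by
    simp [wedge_apply, Matrix.det_fin_three, dw_monoLin, dz_monoLin, dzBar_monoLin]; ring⟩

lemma isInvariant_dz_dwBar_dzBar : IsInvariant (wedge ![dz, dwBar, dzBar]) :=
  ⟨wedge_vert (by intro i; fin_cases i <;> [exact dz_vert; exact dwBar_vert; exact dzBar_vert]),
    fun v => by
    simp [wedge_apply, Matrix.det_fin_three, dwBar_monoLin, dz_monoLin, dzBar_monoLin]; ring⟩

lemma isInvariant_top : IsInvariant (wedge ![dw, dz, dwBar, dzBar]) :=
  ⟨wedge_vert (by
      intro i; fin_cases i <;> [exact dw_vert; exact dz_vert; exact dwBar_vert; exact dzBar_vert]),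
    fun v => by
    simp [wedge_apply, Matrix.det_succ_row_zero, Fin.sum_univ_succ, dw_monoLin, dwBar_monoLin,
      dz_monoLin, dzBar_monoLin, Fin.succAbove]
    ring⟩

/-! ### Values of invariant forms on the coordinate vectors -/

lemma frame_zero : frame 0 = ((1, 0), 0) := rfl
lemma frame_one : frame 1 = ((Complex.I, 0), 0) := rfl
lemma frame_two : frame 2 = ((0, 1), 0) := rfl
lemma frame_three : frame 3 = ((0, Complex.I), 0) := rfl

lemma monoLin_frame_zero : monoLin (frame 0) = frame 0 := by
  ext <;> simp [frame_zero, monoLin, shear]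
lemma monoLin_frame_one : monoLin (frame 1) = frame 1 := by
  ext <;> simp [frame_one, monoLin, shear]
lemma monoLin_frame_two : monoLin (frame 2) = frame 2 + frame 0 := by
  ext <;> simp [frame_zero, frame_two, monoLin, shear]
lemma monoLin_frame_three : monoLin (frame 3) = frame 3 + frame 1 := by
  ext <;> simp [frame_one, frame_three, monoLin, shear]

lemma map_single_add (a : Cover [⋀^Fin 1]→L[ℝ] ℂ) (x y : Cover) :
    a ![x + y] = a ![x] + a ![y] := by
  have h : ∀ s, ![s] = Function.update ![(0 : Cover)] 0 s := by
    intro s; funext i; fin_cases i; rfl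
  rw [h (x + y), h x, h y, a.map_update_add]

lemma map_pair_add_left (a : Cover [⋀^Fin 2]→L[ℝ] ℂ) (x y t : Cover) :
    a ![x + y, t] = a ![x, t] + a ![y, t] := by
  have h : ∀ s, ![s, t] = Function.update ![0, t] 0 s := by
    intro s; funext i; fin_cases i <;> rfl
  rw [h (x + y), h x, h y, a.map_update_add]

lemma map_pair_add_right (a : Cover [⋀^Fin 2]→L[ℝ] ℂ) (x y t : Cover) :
    a ![t, x + y] = a ![t, x] + a ![t, y] := by
  have h : ∀ s, ![t, s] = Function.update ![t, 0] 1 s := by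
    intro s; funext i; fin_cases i <;> rfl
  rw [h (x + y), h x, h y, a.map_update_add]

lemma map_triple_add_mid (a : Cover [⋀^Fin 3]→L[ℝ] ℂ) (x y t s : Cover) :
    a ![t, x + y, s] = a ![t, x, s] + a ![t, y, s] := by
  have h : ∀ r, ![t, r, s] = Function.update ![t, 0, s] 1 r := by
    intro s; funext i; fin_cases i <;> rfl
  rw [h (x + y), h x, h y, a.map_update_add]

lemma map_triple_add_right (a : Cover [⋀^Fin 3]→L[ℝ] ℂ) (x y t s : Cover) :
    a ![t, s, x + y] = a ![t, s, x] + a ![t, s, y] := by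
  have h : ∀ r, ![t, s, r] = Function.update ![t, s, 0] 2 r := by
    intro s; funext i; fin_cases i <;> rfl
  rw [h (x + y), h x, h y, a.map_update_add]

/-- This and the next five lemmas evaluate invariance on one well chosen tuple and expand. The
relations leave `2`, `4` and `2` free values in degrees `1`, `2` and `3`, matching the number of
explicit invariant forms. -/
lemma IsInvariant.one_zero {a : Cover [⋀^Fin 1]→L[ℝ] ℂ} (ha : IsInvariant a) :
    a ![frame 0] = 0 := by
  have h := ha.inv ![frame 2]
  have e : (fun i => monoLin (![frame 2] i)) = ![frame 2 + frame 0] := by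
    funext i; fin_cases i; exact monoLin_frame_two
  rw [e, map_single_add] at h
  simpa using h

lemma IsInvariant.one_one {a : Cover [⋀^Fin 1]→L[ℝ] ℂ} (ha : IsInvariant a) :
    a ![frame 1] = 0 := by
  have h := ha.inv ![frame 3]
  have e : (fun i => monoLin (![frame 3] i)) = ![frame 3 + frame 1] := by
    funext i; fin_cases i; exact monoLin_frame_three
  rw [e, map_single_add] at h
  simpa using h

lemma IsInvariant.two_zero_one {a : Cover [⋀^Fin 2]→L[ℝ] ℂ} (ha : IsInvariant a) :
    a ![frame 0, frame 1] = 0 := by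
  have h := ha.inv ![frame 0, frame 3]
  have e : (fun i => monoLin (![frame 0, frame 3] i)) = ![frame 0, frame 3 + frame 1] := by
    funext i; fin_cases i <;> [exact monoLin_frame_zero; exact monoLin_frame_three]
  rw [e, map_pair_add_right] at h
  simpa using h

/-- On the pair of shifted vectors the cross terms must cancel; this is the relation that ties the
two halves of `θ` together. -/
lemma IsInvariant.two_one_two {a : Cover [⋀^Fin 2]→L[ℝ] ℂ} (ha : IsInvariant a) :
    a ![frame 1, frame 2] = a ![frame 0, frame 3] := by
  have h := ha.inv ![frame 2, frame 3]
  have e : (fun i => monoLin (![frame 2, frame 3] i)) = ![frame 2 + frame 0, frame 3 + frame 1] := by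
    funext i; fin_cases i <;> [exact monoLin_frame_two; exact monoLin_frame_three]
  have hs : a ![frame 2, frame 1] = - a ![frame 1, frame 2] := by
    have := a.toAlternatingMap.map_swap ![frame 1, frame 2] (i := 0) (j := 1) (by decide)
    rw [← show ![frame 1, frame 2] ∘ Equiv.swap (0 : Fin 2) 1 = ![frame 2, frame 1] by
      funext i; fin_cases i <;> rfl]
    exact this
  rw [e, map_pair_add_right, map_pair_add_left, map_pair_add_left, ha.two_zero_one, hs] at h
  linear_combination -h

lemma IsInvariant.three_zero_one_two {a : Cover [⋀^Fin 3]→L[ℝ] ℂ} (ha : IsInvariant a) :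
    a ![frame 0, frame 1, frame 2] = 0 := by
  have h := ha.inv ![frame 0, frame 2, frame 3]
  have e : (fun i => monoLin (![frame 0, frame 2, frame 3] i)) =
      ![frame 0, frame 2 + frame 0, frame 3 + frame 1] := by
    funext i
    fin_cases i <;> [exact monoLin_frame_zero; exact monoLin_frame_two; exact monoLin_frame_three]
  have hs : a ![frame 0, frame 2, frame 1] = - a ![frame 0, frame 1, frame 2] := by
    have := a.toAlternatingMap.map_swap ![frame 0, frame 1, frame 2] (i := 1) (j := 2) (by decide)
    rw [← show ![frame 0, frame 1, frame 2] ∘ Equiv.swap (1 : Fin 3) 2 =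
      ![frame 0, frame 2, frame 1] by funext i; fin_cases i <;> rfl]
    exact this
  have h0 : ∀ t, a ![frame 0, frame 0, t] = 0 := fun t =>
    a.map_eq_zero_of_eq _ (i := 0) (j := 1) rfl (by decide)
  rw [e, map_triple_add_mid, h0, map_triple_add_right, hs] at h
  linear_combination -h

lemma IsInvariant.three_zero_one_three {a : Cover [⋀^Fin 3]→L[ℝ] ℂ} (ha : IsInvariant a) :
    a ![frame 0, frame 1, frame 3] = 0 := by
  have h := ha.inv ![frame 1, frame 2, frame 3]
  have e : (fun i => monoLin (![frame 1, frame 2, frame 3] i)) =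
      ![frame 1, frame 2 + frame 0, frame 3 + frame 1] := by
    funext i
    fin_cases i <;> [exact monoLin_frame_one; exact monoLin_frame_two; exact monoLin_frame_three]
  have hs : a ![frame 1, frame 0, frame 3] = - a ![frame 0, frame 1, frame 3] := by
    have := a.toAlternatingMap.map_swap ![frame 0, frame 1, frame 3] (i := 0) (j := 1) (by decide)
    rw [← show ![frame 0, frame 1, frame 3] ∘ Equiv.swap (0 : Fin 3) 1 =
      ![frame 1, frame 0, frame 3] by funext i; fin_cases i <;> rfl]
    exact this
  have h0 : ∀ t, a ![frame 1, t, frame 1] = 0 := fun t =>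
    a.map_eq_zero_of_eq _ (i := 0) (j := 2) rfl (by decide)
  rw [e, map_triple_add_right, h0, map_triple_add_mid, hs] at h
  linear_combination -h

lemma strictMono_fin_two {v : Fin 2 → Fin 4} (hv : StrictMono v) :
    v ∈ ({![0, 1], ![0, 2], ![0, 3], ![1, 2], ![1, 3], ![2, 3]} : Finset (Fin 2 → Fin 4)) := by
  have h : v 0 < v 1 := hv (by decide)
  revert h
  clear hv
  revert v
  decide

lemma strictMono_fin_three {v : Fin 3 → Fin 4} (hv : StrictMono v) :
    v ∈ ({![0, 1, 2], ![0, 1, 3], ![0, 2, 3], ![1, 2, 3]} : Finset (Fin 3 → Fin 4)) := by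
  have h : v 0 < v 1 ∧ v 1 < v 2 := ⟨hv (by decide), hv (by decide)⟩
  revert h
  clear hv
  revert v
  decide

lemma strictMono_fin_four {v : Fin 4 → Fin 4} (hv : StrictMono v) : v = ![0, 1, 2, 3] := by
  have h01 : v 0 < v 1 := hv (by decide)
  have h12 : v 1 < v 2 := hv (by decide)
  have h23 : v 2 < v 3 := hv (by decide)
  funext i
  fin_cases i <;> simp <;> omega

/-! ### Coordinates on the space of basic forms -/

lemma IsBasic.add {k : ℕ} {α β : KForm k} (ha : IsBasic α) (hb : IsBasic β) : IsBasic (α + β) := by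
  have hs := ha.smooth.add hb.smooth
  have hc : ∀ (x : Cover) (v : Fin k → Cover) (i : Fin k), (v i).1 = 0 → (α + β) x v = 0 :=
    fun x v i hi => by simp [ha.contr x v i hi, hb.contr x v i hi]
  refine ⟨hs, fun m n m' n' x => ?_, fun x v => ?_, hc,
    contr_d_of_transl hs hc fun x u hu => ?_⟩
  · simp [ha.lattice, hb.lattice]
  · simp [ha.mono, hb.mono]
  · simp [ha.transl x u hu, hb.transl x u hu]

/-- The form with coefficients `f` with respect to the invariant forms `1`, `dz`, `dz̄`, `dw ∧ dz`, `θ`,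
`dz ∧ dz̄`, `dw̄ ∧ dz̄`, `dw ∧ dz ∧ dz̄`, `dz ∧ dw̄ ∧ dz̄`, `dw ∧ dz ∧ dw̄ ∧ dz̄`. -/
def ofCoordsRaw (f : Fin 10 → SmoothT2) : RawForm
  | 0 => scaled (f 0).1 (wedge ![])
  | 1 => scaled (f 1).1 (wedge ![dz]) + scaled (f 2).1 (wedge ![dzBar])
  | 2 => scaled (f 3).1 (wedge ![dw, dz]) + scaled (f 4).1 thetaForm +
      scaled (f 5).1 (wedge ![dz, dzBar]) + scaled (f 6).1 (wedge ![dwBar, dzBar])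
  | 3 => scaled (f 7).1 (wedge ![dw, dz, dzBar]) + scaled (f 8).1 (wedge ![dz, dwBar, dzBar])
  | 4 => scaled (f 9).1 (wedge ![dw, dz, dwBar, dzBar])
  | _ + 5 => 0

lemma ofCoordsRaw_mem (f : Fin 10 → SmoothT2) : ofCoordsRaw f ∈ basicForms := by
  rintro (_ | _ | _ | _ | _ | k)
  · exact isInvariant_one.isBasic _
  · exact (isInvariant_dz.isBasic _).add (isInvariant_dzBar.isBasic _)
  · exact (((isInvariant_dw_dz.isBasic _).add (isInvariant_thetaForm.isBasic _)).add
      (isInvariant_dz_dzBar.isBasic _)).add (isInvariant_dwBar_dzBar.isBasic _)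
  · exact (isInvariant_dw_dz_dzBar.isBasic _).add (isInvariant_dz_dwBar_dzBar.isBasic _)
  · exact isInvariant_top.isBasic _
  · exact basicForms.zero_mem _

lemma scaled_add {k : ℕ} (f g : SmoothT2) (a : Cover [⋀^Fin k]→L[ℝ] ℂ) :
    scaled (f + g).1 a = scaled f.1 a + scaled g.1 a :=
  funext fun x => add_smul (f.1 x.1.2) (g.1 x.1.2) a

lemma scaled_smul {k : ℕ} (c : ℂ) (g : SmoothT2) (a : Cover [⋀^Fin k]→L[ℝ] ℂ) :
    scaled (c • g).1 a = c • scaled g.1 a :=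
  funext fun _ => smul_assoc c _ _

lemma scaled_neg {k : ℕ} (g : SmoothT2) (a : Cover [⋀^Fin k]→L[ℝ] ℂ) :
    scaled (-g).1 a = -scaled g.1 a :=
  funext fun x => neg_smul (g.1 x.1.2) a

@[simp] lemma scaled_zero {k : ℕ} (a : Cover [⋀^Fin k]→L[ℝ] ℂ) :
    scaled 0 a = 0 :=
  funext fun _ => zero_smul ℂ a

@[simp] lemma scaled_zero_right {k : ℕ} (g : ℂ → ℂ) :
    scaled g (0 : Cover [⋀^Fin k]→L[ℝ] ℂ) = 0 :=
  funext fun x => smul_zero (A := Cover [⋀^Fin k]→L[ℝ] ℂ) (g x.1.2)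

lemma scaled_neg_right {k : ℕ} (g : ℂ → ℂ) (a : Cover [⋀^Fin k]→L[ℝ] ℂ) :
    scaled g (-a) = -scaled g a :=
  funext fun x => smul_neg (g x.1.2) a

/-- `ofCoordsRaw` as a linear map. -/
def ofCoords : (Fin 10 → SmoothT2) →ₗ[ℂ] basicForms where
  toFun f := ⟨ofCoordsRaw f, ofCoordsRaw_mem f⟩
  map_add' f g := by
    ext1
    funext k
    change ofCoordsRaw (f + g) k = ofCoordsRaw f k + ofCoordsRaw g k
    rcases k with _ | _ | _ | _ | _ | k <;>
      simp only [ofCoordsRaw, Pi.add_apply, scaled_add, add_zero] <;> abel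
  map_smul' c f := by
    ext1
    funext k
    change ofCoordsRaw (c • f) k = c • ofCoordsRaw f k
    rcases k with _ | _ | _ | _ | _ | k <;>
      simp only [ofCoordsRaw, Pi.smul_apply, scaled_smul, smul_add]
    exact (smul_zero (A := KForm (k + 5)) c).symm

lemma ofCoords_val (f : Fin 10 → SmoothT2) : (ofCoords f).1 = ofCoordsRaw f := rfl

lemma frame_pair (i j : Fin 4) : (fun l => frame (![i, j] l)) = ![frame i, frame j] := by
  funext l; fin_cases l <;> rfl

lemma frame_triple (i j k : Fin 4) :
    (fun l => frame (![i, j, k] l)) = ![frame i, frame j, frame k] := by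
  funext l; fin_cases l <;> rfl

lemma dw_frame : dw (frame 0) = 1 ∧ dw (frame 1) = Complex.I ∧ dw (frame 2) = 0 ∧
    dw (frame 3) = 0 := ⟨rfl, rfl, rfl, rfl⟩

lemma dz_frame : dz (frame 0) = 0 ∧ dz (frame 1) = 0 ∧ dz (frame 2) = 1 ∧
    dz (frame 3) = Complex.I := ⟨rfl, rfl, rfl, rfl⟩

lemma dwBar_frame : dwBar (frame 0) = 1 ∧ dwBar (frame 1) = -Complex.I ∧ dwBar (frame 2) = 0 ∧
    dwBar (frame 3) = 0 := by
  simp [dwBar_apply, frame_zero, frame_one, frame_two, frame_three]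

lemma dzBar_frame : dzBar (frame 0) = 0 ∧ dzBar (frame 1) = 0 ∧ dzBar (frame 2) = 1 ∧
    dzBar (frame 3) = -Complex.I := by
  simp [dzBar_apply, frame_zero, frame_one, frame_two, frame_three]

/-- Each conjugate pair contributes `-2i`, and reordering `dw, dz, dw̄, dz̄` into conjugate pairs
costs a sign: `-(-2i)² = 4`. -/
lemma wedge_top_frame : wedge ![dw, dz, dwBar, dzBar] frame = 4 := by
  have h : frame = ![frame 0, frame 1, frame 2, frame 3] := by
    funext i; fin_cases i <;> rfl
  rw [h, wedge_apply]
  simp [Matrix.det_succ_row_zero, Fin.sum_univ_succ, dw_frame, dz_frame, dwBar_frame, dzBar_frame,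
    Fin.succAbove]
  linear_combination -2 * Complex.I_sq

lemma ofCoords_injective : Function.Injective ofCoords := by
  rw [← LinearMap.ker_eq_bot, LinearMap.ker_eq_bot']
  intro f hf
  have h : ∀ k x v, ofCoordsRaw f k x v = 0 := by
    intro k x v
    have : ofCoordsRaw f = 0 := congrArg Subtype.val hf
    rw [this]
    rfl
  have hI := Complex.I_sq
  have key : ∀ z : ℂ, ∀ i, (f i).1 z = 0 := by
    intro z
    -- These ten evaluations form an invertible linear system for the ten coefficients at `z`; the
    -- combinations below are its inverse.
    have h0 := h 0 ((0, z), 0) ![]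
    have h1 := h 1 ((0, z), 0) ![frame 2]
    have h2 := h 1 ((0, z), 0) ![frame 3]
    have h3 := h 2 ((0, z), 0) ![frame 0, frame 2]
    have h4 := h 2 ((0, z), 0) ![frame 0, frame 3]
    have h5 := h 2 ((0, z), 0) ![frame 1, frame 3]
    have h6 := h 2 ((0, z), 0) ![frame 2, frame 3]
    have h7 := h 3 ((0, z), 0) ![frame 0, frame 2, frame 3]
    have h8 := h 3 ((0, z), 0) ![frame 1, frame 2, frame 3]
    have h9 := h 4 ((0, z), 0) frame
    simp only [ofCoordsRaw, Pi.add_apply, ContinuousAlternatingMap.add_apply, scaled_apply,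
      wedge_top_frame, thetaForm] at h0 h1 h2 h3 h4 h5 h6 h7 h8 h9
    simp [wedge_apply, Matrix.det_fin_two, Matrix.det_fin_three, dw_frame, dz_frame, dwBar_frame,
      dzBar_frame] at h0 h1 h2 h3 h4 h5 h6 h7 h8 h9
    intro i
    fin_cases i <;> simp only [Fin.zero_eta, Fin.mk_one, Fin.reduceFinMk]
    · exact h0
    · linear_combination (1 / 2) * h1 - Complex.I / 2 * h2 + ((f 1).1 z - (f 2).1 z) / 2 * hI
    · linear_combination (1 / 2) * h1 + Complex.I / 2 * h2 - ((f 1).1 z - (f 2).1 z) / 2 * hI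
    · linear_combination (h3 - h5) / 4 - Complex.I / 2 * h4 + ((f 3).1 z - (f 6).1 z) / 2 * hI
    · linear_combination (h3 + h5) / 4
    · refine h6.resolve_right fun h => ?_
      have := congrArg Complex.im h
      norm_num at this
    · linear_combination (h3 - h5) / 4 + Complex.I / 2 * h4 - ((f 3).1 z - (f 6).1 z) / 2 * hI
    · linear_combination h8 / 4 + Complex.I / 4 * h7 + ((f 7).1 z - (f 8).1 z) / 2 * hI
    · linear_combination h8 / 4 - Complex.I / 4 * h7 - ((f 7).1 z - (f 8).1 z) / 2 * hI
    · exact h9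
  funext i
  ext z
  exact key z i

/-- The coefficient function obtained by evaluating a basic form on constant vectors. -/
def evalT2 {k : ℕ} {α : KForm k} (h : IsBasic α) (v : Fin k → Cover) : SmoothT2 :=
  ⟨fun z => α ((0, z), 0) v,
    ((ContinuousAlternatingMap.apply ℝ Cover ℂ v).contDiff.comp h.smooth).comp (by fun_prop),
    fun m n z => by
      have := h.lattice 0 0 m n ((0, z), 0)
      rw [gauss_zero] at this
      simp only [Prod.mk_add_mk, add_zero] at this
      exact congrArg (· v) this⟩

lemma evalT2_apply {k : ℕ} {α : KForm k} (h : IsBasic α) (v : Fin k → Cover) (z : ℂ) :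
    (evalT2 h v).1 z = α ((0, z), 0) v := rfl

/-- By `eq_base` only the points `((0, z), 0)` matter, and there the form is determined by its
values on increasing tuples. The coefficients solve the linear system of `ofCoords_injective`, and
the relations for invariant forms settle the remaining tuples. -/
lemma ofCoords_surjective : Function.Surjective ofCoords := by
  intro α
  have hI := Complex.I_sq
  refine ⟨![evalT2 (α.2 0) ![],
    (1 / 2 : ℂ) • (evalT2 (α.2 1) ![frame 2] - Complex.I • evalT2 (α.2 1) ![frame 3]),
    (1 / 2 : ℂ) • (evalT2 (α.2 1) ![frame 2] + Complex.I • evalT2 (α.2 1) ![frame 3]),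
    (1 / 4 : ℂ) • (evalT2 (α.2 2) ![frame 0, frame 2] - evalT2 (α.2 2) ![frame 1, frame 3] -
      (2 * Complex.I) • evalT2 (α.2 2) ![frame 0, frame 3]),
    (1 / 4 : ℂ) • (evalT2 (α.2 2) ![frame 0, frame 2] + evalT2 (α.2 2) ![frame 1, frame 3]),
    (Complex.I / 2) • evalT2 (α.2 2) ![frame 2, frame 3],
    (1 / 4 : ℂ) • (evalT2 (α.2 2) ![frame 0, frame 2] - evalT2 (α.2 2) ![frame 1, frame 3] +
      (2 * Complex.I) • evalT2 (α.2 2) ![frame 0, frame 3]),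
    (1 / 4 : ℂ) • (evalT2 (α.2 3) ![frame 1, frame 2, frame 3] +
      Complex.I • evalT2 (α.2 3) ![frame 0, frame 2, frame 3]),
    (1 / 4 : ℂ) • (evalT2 (α.2 3) ![frame 1, frame 2, frame 3] -
      Complex.I • evalT2 (α.2 3) ![frame 0, frame 2, frame 3]),
    (1 / 4 : ℂ) • evalT2 (α.2 4) frame], ?_⟩
  ext1
  funext k x
  have hα := α.2 k
  have hi := hα.isInvariant ((0, x.1.2), 0)
  refine Eq.trans ?_ (hα.eq_base x).symm
  refine ext_strictMono ((ofCoordsRaw_mem _ k).isInvariant x) hi fun v hv => ?_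
  rcases k with _ | _ | _ | _ | _ | k
  · rw [show (fun i => frame (v i)) = ![] from Subsingleton.elim _ _]
    simp [ofCoords_val, ofCoordsRaw, scaled_apply, wedge_apply, evalT2_apply]
  · have r0 := hi.one_zero
    have r1 := hi.one_one
    have e : (fun i => frame (v i)) = ![frame (v 0)] := by
      funext i; fin_cases i; rfl
    rw [e]
    generalize v 0 = j
    fin_cases j <;> simp only [Fin.zero_eta, Fin.mk_one, Fin.reduceFinMk]
    all_goals
      simp only [ofCoords_val, ofCoordsRaw, Pi.add_apply, ContinuousAlternatingMap.add_apply,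
        scaled_apply, r0, r1]
      simp [wedge_apply, dz_frame, dzBar_frame, evalT2_apply]
    all_goals
      ring_nf
      try simp only [hI]
      try ring
  · have := strictMono_fin_two hv
    simp only [Finset.mem_insert, Finset.mem_singleton] at this
    have r0 := hi.two_zero_one
    have r1 := hi.two_one_two
    rcases this with rfl | rfl | rfl | rfl | rfl | rfl <;> rw [frame_pair]
    all_goals
      simp only [ofCoords_val, ofCoordsRaw, Pi.add_apply, ContinuousAlternatingMap.add_apply,
        scaled_apply, thetaForm, r0, r1]
      simp [wedge_apply, Matrix.det_fin_two, dw_frame, dz_frame, dwBar_frame,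
        dzBar_frame, evalT2_apply]
    all_goals
      ring_nf
      try simp only [hI]
      try ring
  · have := strictMono_fin_three hv
    simp only [Finset.mem_insert, Finset.mem_singleton] at this
    have r0 := hi.three_zero_one_two
    have r1 := hi.three_zero_one_three
    rcases this with rfl | rfl | rfl | rfl <;> rw [frame_triple]
    all_goals
      simp only [ofCoords_val, ofCoordsRaw, Pi.add_apply, ContinuousAlternatingMap.add_apply,
        scaled_apply, r0, r1]
      simp [wedge_apply, Matrix.det_fin_three, dw_frame, dz_frame, dwBar_frame,
        dzBar_frame, evalT2_apply]
    all_goals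
      ring_nf
      try simp only [hI]
      try ring
  · have e : (fun i => frame (v i)) = frame := by
      rw [strictMono_fin_four hv]
      funext i; fin_cases i <;> rfl
    rw [e]
    simp only [ofCoords_val, ofCoordsRaw, scaled_apply, wedge_top_frame]
    simp [evalT2_apply]
    ring
  · rw [eq_zero_of_five_le (by omega) hi]
    rfl

/-! ### The operators and the bidegree in coordinates -/

lemma wirtinger_zero (ε : ℂ) {k : ℕ} : wirtinger ε (0 : KForm k) = 0 := by
  have h : IsBasic (0 : KForm k) := basicForms.zero_mem k
  exact ((congrArg (wirtinger ε) (zero_smul ℂ (0 : KForm k))).symm.trans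
    (wirtinger_smul ε 0 h)).trans (zero_smul ℂ (wirtinger ε (0 : KForm k)))

lemma wedge_eq_zero {k : ℕ} {η : Fin k → Cover →L[ℝ] ℂ} (i j : Fin k) (hij : i ≠ j)
    (h : η i = η j) : wedge η = 0 := by
  ext v
  rw [wedge_apply]
  exact Matrix.det_zero_of_row_eq hij (funext fun l => by simp [h])

lemma wedge_dzBar_dz : wedge ![dzBar, dz] = -wedge ![dz, dzBar] := by
  ext v
  simp [wedge_apply, Matrix.det_fin_two]
  ring

lemma wedge_dzBar_dw_dz : wedge ![dzBar, dw, dz] = wedge ![dw, dz, dzBar] := by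
  ext v
  simp [wedge_apply, Matrix.det_fin_three]
  ring

/-- The summand `dw̄ ∧ dz` of `θ` is killed by `dz`; the sign comes from moving `dz` past `dw`. -/
lemma wedgeLeft_dz_thetaForm : wedgeLeft dz thetaForm = -wedge ![dw, dz, dzBar] := by
  rw [thetaForm, wedgeLeft_add, wedgeLeft_wedge, wedgeLeft_wedge]
  ext v
  simp [wedge_apply, Matrix.det_fin_three]
  ring

lemma wedgeLeft_dzBar_thetaForm : wedgeLeft dzBar thetaForm = -wedge ![dz, dwBar, dzBar] := by
  rw [thetaForm, wedgeLeft_add, wedgeLeft_wedge, wedgeLeft_wedge]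
  ext v
  simp [wedge_apply, Matrix.det_fin_three]
  ring

/-- `∂/∂z` on periodic functions. -/
abbrev dDz : SmoothT2 →ₗ[ℂ] SmoothT2 := wirtDeriv (-Complex.I)

/-- `∂/∂z̄` on periodic functions. -/
abbrev dDzBar : SmoothT2 →ₗ[ℂ] SmoothT2 := wirtDeriv Complex.I

/-- The operator `∂` in coordinates. -/
def coordDel (f : Fin 10 → SmoothT2) : Fin 10 → SmoothT2 :=
  ![0, dDz (f 0), 0, 0, 0, dDz (f 2), 0, -dDz (f 4), dDz (f 6), 0]

/-- The operator `∂̄` in coordinates. -/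
def coordDelBar (f : Fin 10 → SmoothT2) : Fin 10 → SmoothT2 :=
  ![0, 0, dDzBar (f 0), 0, 0, -dDzBar (f 1), 0, dDzBar (f 3), -dDzBar (f 4), 0]

lemma wirtinger_ofCoordsRaw {ε : ℂ} (hε : ε = Complex.I ∨ ε = -Complex.I) (f : Fin 10 → SmoothT2) :
    wirtinger ε (ofCoordsRaw f 0) =
        scaled (wirtDeriv ε (f 0)).1 (wedge ![wirtCovector ε]) ∧
    wirtinger ε (ofCoordsRaw f 1) =
      scaled (wirtDeriv ε (f 1)).1 (wedge ![wirtCovector ε, dz]) +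
        scaled (wirtDeriv ε (f 2)).1 (wedge ![wirtCovector ε, dzBar]) ∧
    wirtinger ε (ofCoordsRaw f 2) =
      scaled (wirtDeriv ε (f 3)).1 (wedge ![wirtCovector ε, dw, dz]) +
        scaled (wirtDeriv ε (f 4)).1 (wedgeLeft (wirtCovector ε) thetaForm) +
        scaled (wirtDeriv ε (f 5)).1 (wedge ![wirtCovector ε, dz, dzBar]) +
        scaled (wirtDeriv ε (f 6)).1 (wedge ![wirtCovector ε, dwBar, dzBar]) ∧
    wirtinger ε (ofCoordsRaw f 3) =
      scaled (wirtDeriv ε (f 7)).1 (wedge ![wirtCovector ε, dw, dz, dzBar]) +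
        scaled (wirtDeriv ε (f 8)).1 (wedge ![wirtCovector ε, dz, dwBar, dzBar]) ∧
    wirtinger ε (ofCoordsRaw f 4) =
      scaled (wirtDeriv ε (f 9)).1 (wedge ![wirtCovector ε, dw, dz, dwBar, dzBar]) := by
  have b1 := isInvariant_dz.isBasic (f 1)
  have b2 := isInvariant_dzBar.isBasic (f 2)
  have b3 := isInvariant_dw_dz.isBasic (f 3)
  have b4 := isInvariant_thetaForm.isBasic (f 4)
  have b5 := isInvariant_dz_dzBar.isBasic (f 5)
  have b6 := isInvariant_dwBar_dzBar.isBasic (f 6)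
  have b7 := isInvariant_dw_dz_dzBar.isBasic (f 7)
  have b8 := isInvariant_dz_dwBar_dzBar.isBasic (f 8)
  refine ⟨?_, ?_, ?_, ?_, ?_⟩ <;> simp only [ofCoordsRaw]
  · rw [wirtinger_scaled hε, wedgeLeft_wedge]
  · rw [wirtinger_add ε b1 b2]
    simp only [wirtinger_scaled hε, wedgeLeft_wedge]
  · rw [wirtinger_add ε ((b3.add b4).add b5) b6, wirtinger_add ε (b3.add b4) b5,
      wirtinger_add ε b3 b4]
    simp only [wirtinger_scaled hε, wedgeLeft_wedge]
  · rw [wirtinger_add ε b7 b8]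
    simp only [wirtinger_scaled hε, wedgeLeft_wedge]
  · rw [wirtinger_scaled hε, wedgeLeft_wedge]

/-- Multiplication by `dz` kills every invariant form containing that factor, so `∂` only sees the
coefficients of `1`, `dz̄`, `θ` and `dw̄ ∧ dz̄`. -/
lemma del_ofCoords (f : Fin 10 → SmoothT2) : del (ofCoords f) = ofCoords (coordDel f) := by
  ext1
  obtain ⟨h0, h1, h2, h3, h4⟩ := wirtinger_ofCoordsRaw (Or.inr rfl) f
  rw [wirtCovector_neg_I] at h0 h1 h2 h3 h4
  funext k
  change wirtingerRaw (-Complex.I) (ofCoordsRaw f) k = ofCoordsRaw (coordDel f) k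
  rcases k with _ | _ | _ | _ | _ | _ | k
  · exact (scaled_zero _).symm
  · refine h0.trans ?_
    simp [ofCoordsRaw, coordDel]
  · refine h1.trans ?_
    rw [wedge_eq_zero (η := ![dz, dz]) 0 1 (by decide) rfl]
    simp [ofCoordsRaw, coordDel]
  · refine h2.trans ?_
    rw [wedge_eq_zero (η := ![dz, dw, dz]) 0 2 (by decide) rfl,
      wedge_eq_zero (η := ![dz, dz, dzBar]) 0 1 (by decide) rfl, wedgeLeft_dz_thetaForm,
      scaled_neg_right, ← scaled_neg]
    simp [ofCoordsRaw, coordDel]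
  · refine h3.trans ?_
    rw [wedge_eq_zero (η := ![dz, dw, dz, dzBar]) 0 2 (by decide) rfl,
      wedge_eq_zero (η := ![dz, dz, dwBar, dzBar]) 0 1 (by decide) rfl]
    simp [ofCoordsRaw, coordDel]
  · refine h4.trans ?_
    rw [wedge_eq_zero (η := ![dz, dw, dz, dwBar, dzBar]) 0 2 (by decide) rfl]
    simp [ofCoordsRaw]
  · exact wirtinger_zero _

lemma delBar_ofCoords (f : Fin 10 → SmoothT2) :
    delBar (ofCoords f) = ofCoords (coordDelBar f) := by
  ext1
  obtain ⟨h0, h1, h2, h3, h4⟩ := wirtinger_ofCoordsRaw (Or.inl rfl) f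
  rw [wirtCovector_I] at h0 h1 h2 h3 h4
  funext k
  change wirtingerRaw Complex.I (ofCoordsRaw f) k = ofCoordsRaw (coordDelBar f) k
  rcases k with _ | _ | _ | _ | _ | _ | k
  · exact (scaled_zero _).symm
  · refine h0.trans ?_
    simp [ofCoordsRaw, coordDelBar]
  · refine h1.trans ?_
    rw [wedge_eq_zero (η := ![dzBar, dzBar]) 0 1 (by decide) rfl, wedge_dzBar_dz,
      scaled_neg_right, ← scaled_neg]
    simp [ofCoordsRaw, coordDelBar]
  · refine h2.trans ?_
    rw [wedge_dzBar_dw_dz, wedge_eq_zero (η := ![dzBar, dz, dzBar]) 0 2 (by decide) rfl,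
      wedge_eq_zero (η := ![dzBar, dwBar, dzBar]) 0 2 (by decide) rfl, wedgeLeft_dzBar_thetaForm,
      scaled_neg_right, ← scaled_neg]
    simp [ofCoordsRaw, coordDelBar]
  · refine h3.trans ?_
    rw [wedge_eq_zero (η := ![dzBar, dw, dz, dzBar]) 0 3 (by decide) rfl,
      wedge_eq_zero (η := ![dzBar, dz, dwBar, dzBar]) 0 3 (by decide) rfl]
    simp [ofCoordsRaw, coordDelBar]
  · refine h4.trans ?_
    rw [wedge_eq_zero (η := ![dzBar, dw, dz, dwBar, dzBar]) 0 4 (by decide) rfl]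
    simp [ofCoordsRaw]
  · exact wirtinger_zero _

/-- The bidegrees of the invariant forms. -/
def coordType : Fin 10 → ℕ × ℕ :=
  ![(0, 0), (1, 0), (0, 1), (2, 0), (1, 1), (1, 1), (0, 2), (2, 1), (1, 2), (2, 2)]

/-- Multiplication of the transverse component of a tangent vector by `c`. -/
def dilate (c : ℂ) (u : Cover) : Cover := (c • u.1, u.2)

lemma wedge_dilate {k : ℕ} {η : Fin k → Cover →L[ℝ] ℂ} {c : ℂ} {χ : Fin k → ℂ}
    (h : ∀ i u, η i (dilate c u) = χ i * η i u) (v : Fin k → Cover) :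
    wedge η (fun i => dilate c (v i)) = (∏ i, χ i) * wedge η v := by
  rw [wedge_apply, wedge_apply, ← Matrix.det_mul_column]
  simp only [h, Matrix.of_apply]

lemma dw_dilate (c : ℂ) (u : Cover) : dw (dilate c u) = c * dw u := rfl
lemma dz_dilate (c : ℂ) (u : Cover) : dz (dilate c u) = c * dz u := rfl
lemma dwBar_dilate (c : ℂ) (u : Cover) : dwBar (dilate c u) = starRingEnd ℂ c * dwBar u :=
  map_mul (starRingEnd ℂ) _ _
lemma dzBar_dilate (c : ℂ) (u : Cover) : dzBar (dilate c u) = starRingEnd ℂ c * dzBar u :=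
  map_mul (starRingEnd ℂ) _ _

/-- The factor by which the coordinates are multiplied under a dilation. -/
def typeFactor (c : ℂ) (t : ℕ × ℕ) : ℂ := c ^ t.1 * (starRingEnd ℂ c) ^ t.2

/-- The ten invariant forms are simultaneous eigenvectors of all dilations. -/
lemma ofCoordsRaw_dilate (c : ℂ) (f : Fin 10 → SmoothT2) (k : ℕ) (x : Cover) (v : Fin k → Cover) :
    ofCoordsRaw f k x (fun i => dilate c (v i)) =
      ofCoordsRaw (fun i => typeFactor c (coordType i) • f i) k x v := by
  have hS : ∀ (s : ℂ) (g : SmoothT2) (z : ℂ), (s • g).1 z = s * g.1 z := fun _ _ _ => rfl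
  have key : ∀ {k : ℕ} (η : Fin k → Cover →L[ℝ] ℂ) (χ : Fin k → ℂ),
      (∀ i u, η i (dilate c u) = χ i * η i u) → ∀ v,
      wedge η (fun i => dilate c (v i)) = (∏ i, χ i) * wedge η v := fun η χ h v => wedge_dilate h v
  set d := starRingEnd ℂ c with hd
  rcases k with _ | _ | _ | _ | _ | k
  · simp [ofCoordsRaw, scaled_apply, coordType, typeFactor, wedge_apply]
  · have e1 := key ![dz] ![c] (by intro i u; fin_cases i; exact dz_dilate c u) v
    have e2 := key ![dzBar] ![d] (by intro i u; fin_cases i; exact dzBar_dilate c u) v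
    simp only [ofCoordsRaw, Pi.add_apply, ContinuousAlternatingMap.add_apply, scaled_apply, e1, e2,
      hS]
    simp [coordType, typeFactor, ← hd]
    ring
  · have e1 := key ![dw, dz] ![c, c]
      (by intro i u; fin_cases i <;> [exact dw_dilate c u; exact dz_dilate c u]) v
    have e2 := key ![dw, dzBar] ![c, d]
      (by intro i u; fin_cases i <;> [exact dw_dilate c u; exact dzBar_dilate c u]) v
    have e3 := key ![dwBar, dz] ![d, c]
      (by intro i u; fin_cases i <;> [exact dwBar_dilate c u; exact dz_dilate c u]) v
    have e4 := key ![dz, dzBar] ![c, d]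
      (by intro i u; fin_cases i <;> [exact dz_dilate c u; exact dzBar_dilate c u]) v
    have e5 := key ![dwBar, dzBar] ![d, d]
      (by intro i u; fin_cases i <;> [exact dwBar_dilate c u; exact dzBar_dilate c u]) v
    simp only [ofCoordsRaw, thetaForm, Pi.add_apply, ContinuousAlternatingMap.add_apply,
      scaled_apply, e1, e2, e3, e4, e5, hS]
    simp [coordType, typeFactor, Fin.prod_univ_succ, ← hd]
    ring
  · have e1 := key ![dw, dz, dzBar] ![c, c, d]
      (by
        intro i u
        fin_cases i <;> [exact dw_dilate c u; exact dz_dilate c u; exact dzBar_dilate c u]) v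
    have e2 := key ![dz, dwBar, dzBar] ![c, d, d]
      (by
        intro i u
        fin_cases i <;> [exact dz_dilate c u; exact dwBar_dilate c u; exact dzBar_dilate c u]) v
    simp only [ofCoordsRaw, Pi.add_apply, ContinuousAlternatingMap.add_apply,
      scaled_apply, e1, e2, hS]
    simp [coordType, typeFactor, Fin.prod_univ_succ, ← hd]
    ring
  · have e1 := key ![dw, dz, dwBar, dzBar] ![c, c, d, d]
      (by
        intro i u
        fin_cases i <;> [exact dw_dilate c u; exact dz_dilate c u; exact dwBar_dilate c u;
          exact dzBar_dilate c u]) v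
    simp only [ofCoordsRaw, scaled_apply, e1, hS]
    simp [coordType, typeFactor, Fin.prod_univ_succ, ← hd]
    ring
  · rfl

/-- The single dilation by `1 + i` separates the bidegrees: the modulus `2^((p+q)/2)` gives `p + q`,
and the argument `(p - q) π / 4` gives `p - q` since `|p - q| ≤ 2`. -/
lemma typeFactor_injOn {t t' : ℕ × ℕ} (h1 : t.1 ≤ 2) (h2 : t.2 ≤ 2) (h1' : t'.1 ≤ 2)
    (h2' : t'.2 ≤ 2) (h : typeFactor (1 + Complex.I) t = typeFactor (1 + Complex.I) t') : t = t' := by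
  obtain ⟨p, q⟩ := t
  obtain ⟨p', q'⟩ := t'
  simp only at h1 h2 h1' h2'
  have hre := congrArg Complex.re h
  have him := congrArg Complex.im h
  clear h
  interval_cases p <;> interval_cases q <;> interval_cases p' <;> interval_cases q' <;>
    first
    | rfl
    | (exfalso; norm_num [typeFactor, pow_two] at hre; done)
    | (exfalso; norm_num [typeFactor, pow_two] at him)

lemma ofCoords_mem_bidegree {p q : ℕ} (hp : p ≤ 2) (hq : q ≤ 2) (f : Fin 10 → SmoothT2) :
    ofCoords f ∈ bidegree p q ↔ ∀ i, coordType i ≠ (p, q) → f i = 0 := by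
  constructor
  · rintro ⟨-, h⟩ i hi
    have e : ofCoords (fun i => typeFactor (1 + Complex.I) (coordType i) • f i) =
        ofCoords (typeFactor (1 + Complex.I) (p, q) • f) := by
      rw [map_smul]
      ext1
      funext k x
      ext v
      refine (ofCoordsRaw_dilate (1 + Complex.I) f k x v).symm.trans ?_
      exact h k x (1 + Complex.I) v
    have e' := congrFun (ofCoords_injective e) i
    by_contra hne
    have e2 := smul_left_injective ℂ hne e'
    refine hi (typeFactor_injOn ?_ ?_ hp hq e2)
    · clear e' e2 hne hi; revert i; decide
    · clear e' e2 hne hi; revert i; decide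
  · intro hf
    refine ⟨fun k hk => ?_, fun k x c v => ?_⟩
    · have hz : ∀ i, (coordType i).1 + (coordType i).2 = k → f i = 0 := by
        intro i hi
        refine hf i fun h => hk ?_
        rw [← hi, h]
      rw [ofCoords_val]
      rcases k with _ | _ | _ | _ | _ | k
      · simp [ofCoordsRaw, hz 0 rfl]
      · simp [ofCoordsRaw, hz 1 rfl, hz 2 rfl]
      · simp [ofCoordsRaw, hz 3 rfl, hz 4 rfl, hz 5 rfl, hz 6 rfl]
      · simp [ofCoordsRaw, hz 7 rfl, hz 8 rfl]
      · simp [ofCoordsRaw, hz 9 rfl]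
      · rfl
    · have e : (fun i => typeFactor c (coordType i) • f i) = typeFactor c (p, q) • f := by
        funext i
        by_cases hi : coordType i = (p, q)
        · rw [hi]; rfl
        · simp [hf i hi]
      refine (ofCoordsRaw_dilate c f k x v).trans ?_
      rw [e]
      change (ofCoords (typeFactor c (p, q) • f)).1 k x v = _
      rw [map_smul]
      rfl

/-! ### Cohomology in coordinates -/

/-- Passage from coordinates to cohomology: `L` selects closed representatives, only the zero one is
exact, and every closed form differs from one of them by an exact form. -/
lemma isoByClasses_of_coords {X : Type} [AddCommGroup X] [Module ℂ X]
    {K I : Submodule ℂ basicForms} {θ : X → RawForm} (L : X →ₗ[ℂ] (Fin 10 → SmoothT2))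
    (hθ : ∀ x, ofCoordsRaw (L x) = θ x) (hK : ∀ x, ofCoords (L x) ∈ K)
    (hinj : ∀ x, ofCoords (L x) ∈ I → x = 0)
    (hsurj : ∀ f, ofCoords f ∈ K → ∃ x, ofCoords (f - L x) ∈ I) : IsoByClasses K I θ := by
  set M : X →ₗ[ℂ] K := (ofCoords ∘ₗ L).codRestrict K hK with hM
  set N : X →ₗ[ℂ] QuotBy K I := (I.submoduleOf K).mkQ ∘ₗ M with hN
  have hb : Function.Bijective N := by
    constructor
    · rw [← LinearMap.ker_eq_bot, LinearMap.ker_eq_bot']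
      intro x hx
      exact hinj x ((Submodule.Quotient.mk_eq_zero (I.submoduleOf K) (x := M x)).1 hx)
    · intro y
      obtain ⟨⟨α, hα⟩, rfl⟩ := (I.submoduleOf K).mkQ_surjective y
      obtain ⟨f, rfl⟩ := ofCoords_surjective α
      obtain ⟨x, hx⟩ := hsurj f hα
      refine ⟨x, ?_⟩
      refine ((Submodule.Quotient.eq _).2 ?_).symm
      rw [map_sub] at hx
      exact hx
  exact ⟨LinearEquiv.ofBijective N hb, fun x => ⟨M x, hθ x, rfl⟩⟩

lemma ofCoords_mem_dolbeaultZ {p q : ℕ} (hp : p ≤ 2) (hq : q ≤ 2) (f : Fin 10 → SmoothT2) :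
    ofCoords f ∈ dolbeaultZ p q ↔
      coordDelBar f = 0 ∧ ∀ i, coordType i ≠ (p, q) → f i = 0 := by
  rw [dolbeaultZ, Submodule.mem_inf, ofCoords_mem_bidegree hp hq, LinearMap.mem_ker,
    delBar_ofCoords, map_eq_zero_iff _ ofCoords_injective]

lemma ofCoords_mem_dolbeaultB {p q : ℕ} (hp : p ≤ 2) (hq : q ≤ 2) (f : Fin 10 → SmoothT2) :
    ofCoords f ∈ dolbeaultB p q ↔
      (∃ g, coordDelBar g = f) ∧ ∀ i, coordType i ≠ (p, q) → f i = 0 := by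
  rw [dolbeaultB, Submodule.mem_inf, ofCoords_mem_bidegree hp hq, LinearMap.mem_range,
    ofCoords_surjective.exists]
  simp only [delBar_ofCoords, ofCoords_injective.eq_iff]

lemma ofCoords_mem_bottChernZ {p q : ℕ} (hp : p ≤ 2) (hq : q ≤ 2) (f : Fin 10 → SmoothT2) :
    ofCoords f ∈ bottChernZ p q ↔
      (coordDel f = 0 ∧ coordDelBar f = 0) ∧ ∀ i, coordType i ≠ (p, q) → f i = 0 := by
  rw [bottChernZ, Submodule.mem_inf, Submodule.mem_inf, ofCoords_mem_bidegree hp hq,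
    LinearMap.mem_ker, LinearMap.mem_ker, del_ofCoords,
    delBar_ofCoords, map_eq_zero_iff _ ofCoords_injective, map_eq_zero_iff _ ofCoords_injective]

lemma ofCoords_mem_bottChernB {p q : ℕ} (hp : p ≤ 2) (hq : q ≤ 2) (f : Fin 10 → SmoothT2) :
    ofCoords f ∈ bottChernB p q ↔
      (∃ g, coordDel (coordDelBar g) = f) ∧ ∀ i, coordType i ≠ (p, q) → f i = 0 := by
  rw [bottChernB, Submodule.mem_inf, ofCoords_mem_bidegree hp hq, LinearMap.mem_range,
    ofCoords_surjective.exists]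
  simp only [LinearMap.comp_apply, delBar_ofCoords, del_ofCoords, ofCoords_injective.eq_iff]

lemma ofCoords_mem_aeppliZ {p q : ℕ} (hp : p ≤ 2) (hq : q ≤ 2) (f : Fin 10 → SmoothT2) :
    ofCoords f ∈ aeppliZ p q ↔
      coordDel (coordDelBar f) = 0 ∧ ∀ i, coordType i ≠ (p, q) → f i = 0 := by
  rw [aeppliZ, Submodule.mem_inf, ofCoords_mem_bidegree hp hq, LinearMap.mem_ker,
    LinearMap.comp_apply, delBar_ofCoords, del_ofCoords, map_eq_zero_iff _ ofCoords_injective]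

lemma ofCoords_mem_aeppliB {p q : ℕ} (hp : p ≤ 2) (hq : q ≤ 2) (f : Fin 10 → SmoothT2) :
    ofCoords f ∈ aeppliB p q ↔
      (∃ g h, coordDel g + coordDelBar h = f) ∧ ∀ i, coordType i ≠ (p, q) → f i = 0 := by
  rw [aeppliB, Submodule.mem_inf, ofCoords_mem_bidegree hp hq, Submodule.mem_sup]
  refine and_congr_left fun _ => ?_
  constructor
  · rintro ⟨_, ⟨α, rfl⟩, _, ⟨β, rfl⟩, h⟩
    obtain ⟨g, rfl⟩ := ofCoords_surjective α
    obtain ⟨g', rfl⟩ := ofCoords_surjective β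
    rw [del_ofCoords, delBar_ofCoords, ← map_add] at h
    exact ⟨g, g', ofCoords_injective h⟩
  · rintro ⟨g, g', rfl⟩
    exact ⟨_, ⟨ofCoords g, del_ofCoords g⟩, _, ⟨ofCoords g', delBar_ofCoords g'⟩,
      (map_add ofCoords _ _).symm⟩

/-- The forms with a single nonzero coefficient. -/
abbrev coordSingle (i : Fin 10) : SmoothT2 →ₗ[ℂ] (Fin 10 → SmoothT2) :=
  LinearMap.single ℂ (fun _ => SmoothT2) i

lemma support_iff_eq_single {i : Fin 10} {p q : ℕ} (h : ∀ j, coordType j = (p, q) ↔ j = i)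
    (f : Fin 10 → SmoothT2) :
    (∀ j, coordType j ≠ (p, q) → f j = 0) ↔ f = coordSingle i (f i) := by
  constructor
  · intro hf
    funext j
    by_cases hj : j = i
    · subst hj; simp
    · rw [hf j fun h' => hj ((h j).1 h')]
      simp [hj]
  · intro hf j hj
    rw [hf]
    simp [show j ≠ i from fun h' => hj ((h j).2 h')]

/-- A cohomology space in a bidegree with one invariant form. -/
lemma isoByClasses_single {X : Type} [AddCommGroup X] [Module ℂ X]
    {K I : Submodule ℂ basicForms} {θ : X → RawForm} (i : Fin 10) (ι : X →ₗ[ℂ] SmoothT2)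
    {p q : ℕ} (ht : ∀ j, coordType j = (p, q) ↔ j = i) {A B : (Fin 10 → SmoothT2) → Prop}
    (hK : ∀ f, ofCoords f ∈ K ↔ A f ∧ ∀ j, coordType j ≠ (p, q) → f j = 0)
    (hI : ∀ f, ofCoords f ∈ I ↔ B f ∧ ∀ j, coordType j ≠ (p, q) → f j = 0)
    (hθ : ∀ x, ofCoordsRaw (coordSingle i (ι x)) = θ x)
    (hA : ∀ x, A (coordSingle i (ι x)))
    (hinj : ∀ x, B (coordSingle i (ι x)) → x = 0)
    (hsurj : ∀ s, A (coordSingle i s) → ∃ x, B (coordSingle i (s - ι x))) :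
    IsoByClasses K I θ := by
  simp only [support_iff_eq_single ht] at hK hI
  refine isoByClasses_of_coords (coordSingle i ∘ₗ ι) hθ (fun x => ?_) (fun x hx => ?_)
    fun f hf => ?_
  · rw [hK]
    exact ⟨hA x, by simp⟩
  · exact hinj x ((hI _).1 hx).1
  · obtain ⟨h1, h2⟩ := (hK f).1 hf
    rw [h2] at h1
    obtain ⟨x, hx⟩ := hsurj _ h1
    refine ⟨x, (hI _).2 ?_⟩
    have e : f - (coordSingle i ∘ₗ ι) x = coordSingle i (f i - ι x) := by
      rw [LinearMap.comp_apply, map_sub, ← h2]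
    rw [e]
    exact ⟨hx, by simp⟩

lemma ofCoordsRaw_single_zero (s : SmoothT2) :
    ofCoordsRaw (coordSingle 0 s) = term s.1 ![] := by
  funext k
  rcases k with _ | _ | _ | _ | _ | k <;> simp [ofCoordsRaw, term]
  rfl

lemma ofCoordsRaw_single_one (s : SmoothT2) :
    ofCoordsRaw (coordSingle 1 s) = term s.1 ![dz] := by
  funext k
  rcases k with _ | _ | _ | _ | _ | k <;> simp [ofCoordsRaw, term]
  rfl

lemma ofCoordsRaw_single_two (s : SmoothT2) :
    ofCoordsRaw (coordSingle 2 s) = term s.1 ![dzBar] := by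
  funext k
  rcases k with _ | _ | _ | _ | _ | k <;> simp [ofCoordsRaw, term]
  rfl

lemma ofCoordsRaw_single_three (s : SmoothT2) :
    ofCoordsRaw (coordSingle 3 s) = term s.1 ![dw, dz] := by
  funext k
  rcases k with _ | _ | _ | _ | _ | k <;> simp [ofCoordsRaw, term]
  rfl

lemma ofCoordsRaw_single_six (s : SmoothT2) :
    ofCoordsRaw (coordSingle 6 s) = term s.1 ![dwBar, dzBar] := by
  funext k
  rcases k with _ | _ | _ | _ | _ | k <;> simp [ofCoordsRaw, term]
  rfl

lemma ofCoordsRaw_single_seven (s : SmoothT2) :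
    ofCoordsRaw (coordSingle 7 s) = term s.1 ![dw, dz, dzBar] := by
  funext k
  rcases k with _ | _ | _ | _ | _ | k <;> simp [ofCoordsRaw, term]
  rfl

lemma ofCoordsRaw_single_eight (s : SmoothT2) :
    ofCoordsRaw (coordSingle 8 s) = term s.1 ![dz, dwBar, dzBar] := by
  funext k
  rcases k with _ | _ | _ | _ | _ | k <;> simp [ofCoordsRaw, term]
  rfl

lemma ofCoordsRaw_single_nine (s : SmoothT2) :
    ofCoordsRaw (coordSingle 9 s) = term s.1 ![dw, dz, dwBar, dzBar] := by
  funext k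
  rcases k with _ | _ | _ | _ | _ | k <;> simp [ofCoordsRaw, term]
  rfl

/-! ### The operators as systems of equations -/

lemma coordDel_eq_iff (f g : Fin 10 → SmoothT2) : coordDel f = g ↔
    g 0 = 0 ∧ g 1 = dDz (f 0) ∧ g 2 = 0 ∧ g 3 = 0 ∧ g 4 = 0 ∧ g 5 = dDz (f 2) ∧ g 6 = 0 ∧
      g 7 = -dDz (f 4) ∧ g 8 = dDz (f 6) ∧ g 9 = 0 := by
  rw [eq_comm, funext_iff]
  simp [Fin.forall_fin_succ, coordDel]

lemma coordDelBar_eq_iff (f g : Fin 10 → SmoothT2) : coordDelBar f = g ↔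
    g 0 = 0 ∧ g 1 = 0 ∧ g 2 = dDzBar (f 0) ∧ g 3 = 0 ∧ g 4 = 0 ∧ g 5 = -dDzBar (f 1) ∧ g 6 = 0 ∧
      g 7 = dDzBar (f 3) ∧ g 8 = -dDzBar (f 4) ∧ g 9 = 0 := by
  rw [eq_comm, funext_iff]
  simp [Fin.forall_fin_succ, coordDelBar]

/-- The image of `∂̄` involves `dz̄` in every term, and `∂` is nonzero only on its component along
`dz̄` itself; hence the single surviving entry. -/
lemma coordDel_coordDelBar_eq_iff (f g : Fin 10 → SmoothT2) : coordDel (coordDelBar f) = g ↔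
    g 5 = dDz (dDzBar (f 0)) ∧ ∀ i, i ≠ 5 → g i = 0 := by
  rw [coordDel_eq_iff]
  simp [Fin.forall_fin_succ, coordDelBar]
  tauto

lemma coordDel_add_coordDelBar_eq_iff (f h g : Fin 10 → SmoothT2) :
    coordDel f + coordDelBar h = g ↔
    g 0 = 0 ∧ g 1 = dDz (f 0) ∧ g 2 = dDzBar (h 0) ∧ g 3 = 0 ∧ g 4 = 0 ∧
      g 5 = dDz (f 2) - dDzBar (h 1) ∧ g 6 = 0 ∧ g 7 = -dDz (f 4) + dDzBar (h 3) ∧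
      g 8 = dDz (f 6) - dDzBar (h 4) ∧ g 9 = 0 := by
  rw [eq_comm, funext_iff]
  simp [Fin.forall_fin_succ, coordDel, coordDelBar, sub_eq_add_neg]

/-- The case where the closed coefficients are the constants and no nonzero form is exact. -/
lemma isoByClasses_const {K I : Submodule ℂ basicForms} {θ : ℂ → RawForm} (i : Fin 10)
    {p q : ℕ} (ht : ∀ j, coordType j = (p, q) ↔ j = i) {A B : (Fin 10 → SmoothT2) → Prop}
    (hK : ∀ f, ofCoords f ∈ K ↔ A f ∧ ∀ j, coordType j ≠ (p, q) → f j = 0)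
    (hI : ∀ f, ofCoords f ∈ I ↔ B f ∧ ∀ j, coordType j ≠ (p, q) → f j = 0)
    (hθ : ∀ x, ofCoordsRaw (coordSingle i (constT2 x)) = θ x)
    (hA : ∀ s, A (coordSingle i s) ↔ s = constT2 (meanT2 s))
    (hB : ∀ s, B (coordSingle i s) ↔ s = 0) : IsoByClasses K I θ := by
  refine isoByClasses_single i constT2 ht hK hI hθ (fun x => ?_) (fun x hx => ?_) fun s hs => ?_
  · rw [hA, meanT2_constT2]
  · rw [hB, map_eq_zero_iff _ constT2_injective] at hx
    exact hx
  · refine ⟨meanT2 s, ?_⟩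
    rw [hB, sub_eq_zero]
    exact (hA s).1 hs

/-- The case where every form is closed and the exact coefficients are those with mean zero. -/
lemma isoByClasses_mean {K I : Submodule ℂ basicForms} {θ : ℂ → RawForm} (i : Fin 10)
    {p q : ℕ} (ht : ∀ j, coordType j = (p, q) ↔ j = i) {A B : (Fin 10 → SmoothT2) → Prop}
    (hK : ∀ f, ofCoords f ∈ K ↔ A f ∧ ∀ j, coordType j ≠ (p, q) → f j = 0)
    (hI : ∀ f, ofCoords f ∈ I ↔ B f ∧ ∀ j, coordType j ≠ (p, q) → f j = 0)
    (hθ : ∀ x, ofCoordsRaw (coordSingle i (constT2 x)) = θ x)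
    (hA : ∀ s, A (coordSingle i s))
    (hB : ∀ s, B (coordSingle i s) ↔ meanT2 s = 0) : IsoByClasses K I θ := by
  refine isoByClasses_single i constT2 ht hK hI hθ (fun x => hA _) (fun x hx => ?_) fun s hs => ?_
  · rwa [hB, meanT2_constT2] at hx
  · refine ⟨meanT2 s, ?_⟩
    rw [hB, map_sub, meanT2_constT2, sub_self]

/-- The case where every form is closed and no nonzero form is exact. -/
lemma isoByClasses_smooth {K I : Submodule ℂ basicForms} {θ : SmoothT2 → RawForm} (i : Fin 10)
    {p q : ℕ} (ht : ∀ j, coordType j = (p, q) ↔ j = i) {A B : (Fin 10 → SmoothT2) → Prop}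
    (hK : ∀ f, ofCoords f ∈ K ↔ A f ∧ ∀ j, coordType j ≠ (p, q) → f j = 0)
    (hI : ∀ f, ofCoords f ∈ I ↔ B f ∧ ∀ j, coordType j ≠ (p, q) → f j = 0)
    (hθ : ∀ x, ofCoordsRaw (coordSingle i x) = θ x)
    (hA : ∀ s, A (coordSingle i s))
    (hB : ∀ s, B (coordSingle i s) ↔ s = 0) : IsoByClasses K I θ := by
  refine isoByClasses_single i LinearMap.id ht hK hI hθ (fun x => hA _) (fun x hx => (hB _).1 hx)
    fun s hs => ⟨s, ?_⟩
  rw [hB]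
  exact sub_self s

/-! ### Closed and exact coefficients -/

lemma dDz_eq_zero_iff (s : SmoothT2) : dDz s = 0 ↔ s = constT2 (meanT2 s) :=
  ⟨eq_constT2_of_wirtDeriv_eq_zero (Or.inr rfl), fun h => by rw [h, wirtDeriv_constT2]⟩

lemma dDzBar_eq_zero_iff (s : SmoothT2) : dDzBar s = 0 ↔ s = constT2 (meanT2 s) :=
  ⟨eq_constT2_of_wirtDeriv_eq_zero (Or.inl rfl), fun h => by rw [h, wirtDeriv_constT2]⟩

/-- A derivative has mean zero, so it is constant only when it vanishes. -/
lemma dDz_dDzBar_eq_zero_iff (s : SmoothT2) :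
    dDz (dDzBar s) = 0 ↔ s = constT2 (meanT2 s) := by
  rw [dDz_eq_zero_iff, meanT2_wirtDeriv, map_zero, dDzBar_eq_zero_iff]

lemma mean_eq_zero_iff_dDz (s : SmoothT2) : meanT2 s = 0 ↔ ∃ g, s = dDz g :=
  ⟨fun h => (exists_wirtDeriv_eq (Or.inr rfl) h).imp fun _ h => h.1.symm,
    fun ⟨g, hg⟩ => by rw [hg, meanT2_wirtDeriv]⟩

lemma mean_eq_zero_iff_dDzBar (s : SmoothT2) : meanT2 s = 0 ↔ ∃ g, s = dDzBar g :=
  ⟨fun h => (exists_wirtDeriv_eq (Or.inl rfl) h).imp fun _ h => h.1.symm,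
    fun ⟨g, hg⟩ => by rw [hg, meanT2_wirtDeriv]⟩

/-- The first primitive is taken with mean zero and so has a primitive itself. -/
lemma mean_eq_zero_iff_dDz_dDzBar (s : SmoothT2) : meanT2 s = 0 ↔ ∃ g, s = dDz (dDzBar g) := by
  refine ⟨fun h => ?_, fun ⟨g, hg⟩ => by rw [hg, meanT2_wirtDeriv]⟩
  obtain ⟨f, rfl, hf⟩ := exists_wirtDeriv_eq (Or.inr rfl) h
  obtain ⟨g, rfl, -⟩ := exists_wirtDeriv_eq (Or.inl rfl) hf
  exact ⟨g, rfl⟩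

lemma coordDelBar_eq_zero_iff (f : Fin 10 → SmoothT2) : coordDelBar f = 0 ↔
    f 0 = constT2 (meanT2 (f 0)) ∧ f 1 = constT2 (meanT2 (f 1)) ∧ f 3 = constT2 (meanT2 (f 3)) ∧
      f 4 = constT2 (meanT2 (f 4)) := by
  simp only [coordDelBar_eq_iff, ← dDzBar_eq_zero_iff, Pi.zero_apply, zero_eq_neg, true_and,
    and_true, eq_comm]

lemma coordDel_eq_zero_iff (f : Fin 10 → SmoothT2) : coordDel f = 0 ↔
    f 0 = constT2 (meanT2 (f 0)) ∧ f 2 = constT2 (meanT2 (f 2)) ∧ f 4 = constT2 (meanT2 (f 4)) ∧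
      f 6 = constT2 (meanT2 (f 6)) := by
  simp only [coordDel_eq_iff, ← dDz_eq_zero_iff, Pi.zero_apply, zero_eq_neg, true_and,
    and_true, eq_comm]

lemma coordDel_coordDelBar_eq_zero_iff (f : Fin 10 → SmoothT2) :
    coordDel (coordDelBar f) = 0 ↔ f 0 = constT2 (meanT2 (f 0)) := by
  rw [coordDel_coordDelBar_eq_iff, ← dDz_dDzBar_eq_zero_iff]
  simp [eq_comm]

lemma exists_coordDelBar_eq_iff (g : Fin 10 → SmoothT2) : (∃ f, coordDelBar f = g) ↔
    g 0 = 0 ∧ g 1 = 0 ∧ meanT2 (g 2) = 0 ∧ g 3 = 0 ∧ g 4 = 0 ∧ meanT2 (g 5) = 0 ∧ g 6 = 0 ∧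
      meanT2 (g 7) = 0 ∧ meanT2 (g 8) = 0 ∧ g 9 = 0 := by
  simp only [coordDelBar_eq_iff]
  constructor
  · rintro ⟨f, h0, h1, h2, h3, h4, h5, h6, h7, h8, h9⟩
    simp [h0, h1, h2, h3, h4, h5, h6, h7, h8, h9]
  · rintro ⟨h0, h1, h2, h3, h4, h5, h6, h7, h8, h9⟩
    obtain ⟨a, ha⟩ := (mean_eq_zero_iff_dDzBar _).1 h2
    obtain ⟨b, hb⟩ := (mean_eq_zero_iff_dDzBar _).1 h5
    obtain ⟨c, hc⟩ := (mean_eq_zero_iff_dDzBar _).1 h7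
    obtain ⟨d, hd⟩ := (mean_eq_zero_iff_dDzBar _).1 h8
    -- The four equations involve different coefficients of the preimage and are solved separately;
    -- the signs are those of `coordDelBar`.
    refine ⟨![a, -b, 0, c, -d, 0, 0, 0, 0, 0], h0, h1, ha, h3, h4, ?_, h6, hc, ?_, h9⟩
    · simpa using hb
    · simpa using hd

lemma exists_coordDel_coordDelBar_eq_iff (g : Fin 10 → SmoothT2) :
    (∃ f, coordDel (coordDelBar f) = g) ↔ meanT2 (g 5) = 0 ∧ ∀ i, i ≠ 5 → g i = 0 := by
  simp only [coordDel_coordDelBar_eq_iff, exists_and_right, mean_eq_zero_iff_dDz_dDzBar]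
  refine and_congr_left fun _ => ⟨fun ⟨f, hf⟩ => ⟨f 0, hf⟩, fun ⟨a, ha⟩ => ⟨fun _ => a, ha⟩⟩

lemma exists_coordDel_add_coordDelBar_eq_iff (g : Fin 10 → SmoothT2) :
    (∃ f h, coordDel f + coordDelBar h = g) ↔
    g 0 = 0 ∧ meanT2 (g 1) = 0 ∧ meanT2 (g 2) = 0 ∧ g 3 = 0 ∧ g 4 = 0 ∧ meanT2 (g 5) = 0 ∧
      g 6 = 0 ∧ meanT2 (g 7) = 0 ∧ meanT2 (g 8) = 0 ∧ g 9 = 0 := by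
  simp only [coordDel_add_coordDelBar_eq_iff]
  constructor
  · rintro ⟨f, h, h0, h1, h2, h3, h4, h5, h6, h7, h8, h9⟩
    simp [h0, h1, h2, h3, h4, h5, h6, h7, h8, h9]
  · rintro ⟨h0, h1, h2, h3, h4, h5, h6, h7, h8, h9⟩
    obtain ⟨a, ha⟩ := (mean_eq_zero_iff_dDz _).1 h1
    obtain ⟨b, hb⟩ := (mean_eq_zero_iff_dDzBar _).1 h2
    obtain ⟨c, hc⟩ := (mean_eq_zero_iff_dDz _).1 h5
    obtain ⟨d, hd⟩ := (mean_eq_zero_iff_dDzBar _).1 h7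
    obtain ⟨e, he⟩ := (mean_eq_zero_iff_dDz _).1 h8
    -- The entries `5`, `7`, `8` can be reached by both operators. Each is reached here by one that
    -- avoids the coefficient of `θ`, which would affect other entries as well.
    refine ⟨![a, 0, c, 0, 0, 0, e, 0, 0, 0], ![b, 0, 0, d, 0, 0, 0, 0, 0, 0], h0, ha, hb, h3, h4,
      ?_, h6, ?_, ?_, h9⟩
    · simpa using hc
    · simpa using hd
    · simpa using he

/-! ### The entries of the three tables -/

lemma dolbeaultVia_zero_zero :
    DolbeaultVia 0 0 (fun a : ℂ => term (fun _ => a) ![]) :=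
  isoByClasses_const 0 (by decide) (ofCoords_mem_dolbeaultZ (by decide) (by decide))
    (ofCoords_mem_dolbeaultB (by decide) (by decide)) (fun _ => ofCoordsRaw_single_zero _)
    (fun s => by simp [coordDelBar_eq_zero_iff])
    (fun s => by simp [exists_coordDelBar_eq_iff])

lemma dolbeaultVia_zero_one :
    DolbeaultVia 0 1 (fun a : ℂ => term (fun _ => a) ![dzBar]) :=
  isoByClasses_mean 2 (by decide) (ofCoords_mem_dolbeaultZ (by decide) (by decide))
    (ofCoords_mem_dolbeaultB (by decide) (by decide)) (fun _ => ofCoordsRaw_single_two _)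
    (fun s => by simp [coordDelBar_eq_zero_iff])
    (fun s => by simp [exists_coordDelBar_eq_iff])

lemma dolbeaultVia_zero_two :
    DolbeaultVia 0 2 (fun g : SmoothT2 => term g.1 ![dwBar, dzBar]) :=
  isoByClasses_smooth 6 (by decide) (ofCoords_mem_dolbeaultZ (by decide) (by decide))
    (ofCoords_mem_dolbeaultB (by decide) (by decide)) (fun _ => ofCoordsRaw_single_six _)
    (fun s => by simp [coordDelBar_eq_zero_iff])
    (fun s => by simp [exists_coordDelBar_eq_iff])

lemma dolbeaultVia_one_zero :
    DolbeaultVia 1 0 (fun a : ℂ => term (fun _ => a) ![dz]) :=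
  isoByClasses_const 1 (by decide) (ofCoords_mem_dolbeaultZ (by decide) (by decide))
    (ofCoords_mem_dolbeaultB (by decide) (by decide)) (fun _ => ofCoordsRaw_single_one _)
    (fun s => by simp [coordDelBar_eq_zero_iff])
    (fun s => by simp [exists_coordDelBar_eq_iff])

lemma dolbeaultVia_one_two :
    DolbeaultVia 1 2 (fun a : ℂ => term (fun _ => a) ![dz, dwBar, dzBar]) :=
  isoByClasses_mean 8 (by decide) (ofCoords_mem_dolbeaultZ (by decide) (by decide))
    (ofCoords_mem_dolbeaultB (by decide) (by decide)) (fun _ => ofCoordsRaw_single_eight _)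
    (fun s => by simp [coordDelBar_eq_zero_iff])
    (fun s => by simp [exists_coordDelBar_eq_iff])

lemma dolbeaultVia_two_zero :
    DolbeaultVia 2 0 (fun a : ℂ => term (fun _ => a) ![dw, dz]) :=
  isoByClasses_const 3 (by decide) (ofCoords_mem_dolbeaultZ (by decide) (by decide))
    (ofCoords_mem_dolbeaultB (by decide) (by decide)) (fun _ => ofCoordsRaw_single_three _)
    (fun s => by simp [coordDelBar_eq_zero_iff])
    (fun s => by simp [exists_coordDelBar_eq_iff])

lemma dolbeaultVia_two_one :
    DolbeaultVia 2 1 (fun a : ℂ => term (fun _ => a) ![dw, dz, dzBar]) :=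
  isoByClasses_mean 7 (by decide) (ofCoords_mem_dolbeaultZ (by decide) (by decide))
    (ofCoords_mem_dolbeaultB (by decide) (by decide)) (fun _ => ofCoordsRaw_single_seven _)
    (fun s => by simp [coordDelBar_eq_zero_iff])
    (fun s => by simp [exists_coordDelBar_eq_iff])

lemma dolbeaultVia_two_two :
    DolbeaultVia 2 2 (fun g : SmoothT2 => term g.1 ![dw, dz, dwBar, dzBar]) :=
  isoByClasses_smooth 9 (by decide) (ofCoords_mem_dolbeaultZ (by decide) (by decide))
    (ofCoords_mem_dolbeaultB (by decide) (by decide)) (fun _ => ofCoordsRaw_single_nine _)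
    (fun s => by simp [coordDelBar_eq_zero_iff])
    (fun s => by simp [exists_coordDelBar_eq_iff])

lemma bottChernVia_zero_zero :
    BottChernVia 0 0 (fun a : ℂ => term (fun _ => a) ![]) :=
  isoByClasses_const 0 (by decide) (ofCoords_mem_bottChernZ (by decide) (by decide))
    (ofCoords_mem_bottChernB (by decide) (by decide)) (fun _ => ofCoordsRaw_single_zero _)
    (fun s => by simp [coordDel_eq_zero_iff, coordDelBar_eq_zero_iff])
    (fun s => by simp [exists_coordDel_coordDelBar_eq_iff, Fin.forall_fin_succ])

lemma bottChernVia_zero_one :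
    BottChernVia 0 1 (fun a : ℂ => term (fun _ => a) ![dzBar]) :=
  isoByClasses_const 2 (by decide) (ofCoords_mem_bottChernZ (by decide) (by decide))
    (ofCoords_mem_bottChernB (by decide) (by decide)) (fun _ => ofCoordsRaw_single_two _)
    (fun s => by simp [coordDel_eq_zero_iff, coordDelBar_eq_zero_iff])
    (fun s => by simp [exists_coordDel_coordDelBar_eq_iff, Fin.forall_fin_succ])

lemma bottChernVia_zero_two :
    BottChernVia 0 2 (fun a : ℂ => term (fun _ => a) ![dwBar, dzBar]) :=
  isoByClasses_const 6 (by decide) (ofCoords_mem_bottChernZ (by decide) (by decide))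
    (ofCoords_mem_bottChernB (by decide) (by decide)) (fun _ => ofCoordsRaw_single_six _)
    (fun s => by simp [coordDel_eq_zero_iff, coordDelBar_eq_zero_iff])
    (fun s => by simp [exists_coordDel_coordDelBar_eq_iff, Fin.forall_fin_succ])

lemma bottChernVia_one_zero :
    BottChernVia 1 0 (fun a : ℂ => term (fun _ => a) ![dz]) :=
  isoByClasses_const 1 (by decide) (ofCoords_mem_bottChernZ (by decide) (by decide))
    (ofCoords_mem_bottChernB (by decide) (by decide)) (fun _ => ofCoordsRaw_single_one _)
    (fun s => by simp [coordDel_eq_zero_iff, coordDelBar_eq_zero_iff])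
    (fun s => by simp [exists_coordDel_coordDelBar_eq_iff, Fin.forall_fin_succ])

lemma bottChernVia_one_two :
    BottChernVia 1 2 (fun g : SmoothT2 => term g.1 ![dz, dwBar, dzBar]) :=
  isoByClasses_smooth 8 (by decide) (ofCoords_mem_bottChernZ (by decide) (by decide))
    (ofCoords_mem_bottChernB (by decide) (by decide)) (fun _ => ofCoordsRaw_single_eight _)
    (fun s => by simp [coordDel_eq_zero_iff, coordDelBar_eq_zero_iff])
    (fun s => by simp [exists_coordDel_coordDelBar_eq_iff, Fin.forall_fin_succ])

lemma bottChernVia_two_zero :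
    BottChernVia 2 0 (fun a : ℂ => term (fun _ => a) ![dw, dz]) :=
  isoByClasses_const 3 (by decide) (ofCoords_mem_bottChernZ (by decide) (by decide))
    (ofCoords_mem_bottChernB (by decide) (by decide)) (fun _ => ofCoordsRaw_single_three _)
    (fun s => by simp [coordDel_eq_zero_iff, coordDelBar_eq_zero_iff])
    (fun s => by simp [exists_coordDel_coordDelBar_eq_iff, Fin.forall_fin_succ])

lemma bottChernVia_two_one :
    BottChernVia 2 1 (fun g : SmoothT2 => term g.1 ![dw, dz, dzBar]) :=
  isoByClasses_smooth 7 (by decide) (ofCoords_mem_bottChernZ (by decide) (by decide))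
    (ofCoords_mem_bottChernB (by decide) (by decide)) (fun _ => ofCoordsRaw_single_seven _)
    (fun s => by simp [coordDel_eq_zero_iff, coordDelBar_eq_zero_iff])
    (fun s => by simp [exists_coordDel_coordDelBar_eq_iff, Fin.forall_fin_succ])

lemma bottChernVia_two_two :
    BottChernVia 2 2 (fun g : SmoothT2 => term g.1 ![dw, dz, dwBar, dzBar]) :=
  isoByClasses_smooth 9 (by decide) (ofCoords_mem_bottChernZ (by decide) (by decide))
    (ofCoords_mem_bottChernB (by decide) (by decide)) (fun _ => ofCoordsRaw_single_nine _)
    (fun s => by simp [coordDel_eq_zero_iff, coordDelBar_eq_zero_iff])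
    (fun s => by simp [exists_coordDel_coordDelBar_eq_iff, Fin.forall_fin_succ])

lemma aeppliVia_zero_zero :
    AeppliVia 0 0 (fun a : ℂ => term (fun _ => a) ![]) :=
  isoByClasses_const 0 (by decide) (ofCoords_mem_aeppliZ (by decide) (by decide))
    (ofCoords_mem_aeppliB (by decide) (by decide)) (fun _ => ofCoordsRaw_single_zero _)
    (fun s => by simp [coordDel_coordDelBar_eq_zero_iff])
    (fun s => by simp [exists_coordDel_add_coordDelBar_eq_iff])

lemma aeppliVia_zero_one :
    AeppliVia 0 1 (fun a : ℂ => term (fun _ => a) ![dzBar]) :=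
  isoByClasses_mean 2 (by decide) (ofCoords_mem_aeppliZ (by decide) (by decide))
    (ofCoords_mem_aeppliB (by decide) (by decide)) (fun _ => ofCoordsRaw_single_two _)
    (fun s => by simp [coordDel_coordDelBar_eq_zero_iff])
    (fun s => by simp [exists_coordDel_add_coordDelBar_eq_iff])

lemma aeppliVia_zero_two :
    AeppliVia 0 2 (fun g : SmoothT2 => term g.1 ![dwBar, dzBar]) :=
  isoByClasses_smooth 6 (by decide) (ofCoords_mem_aeppliZ (by decide) (by decide))
    (ofCoords_mem_aeppliB (by decide) (by decide)) (fun _ => ofCoordsRaw_single_six _)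
    (fun s => by simp [coordDel_coordDelBar_eq_zero_iff])
    (fun s => by simp [exists_coordDel_add_coordDelBar_eq_iff])

lemma aeppliVia_one_zero :
    AeppliVia 1 0 (fun a : ℂ => term (fun _ => a) ![dz]) :=
  isoByClasses_mean 1 (by decide) (ofCoords_mem_aeppliZ (by decide) (by decide))
    (ofCoords_mem_aeppliB (by decide) (by decide)) (fun _ => ofCoordsRaw_single_one _)
    (fun s => by simp [coordDel_coordDelBar_eq_zero_iff])
    (fun s => by simp [exists_coordDel_add_coordDelBar_eq_iff])

lemma aeppliVia_one_two :
    AeppliVia 1 2 (fun a : ℂ => term (fun _ => a) ![dz, dwBar, dzBar]) :=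
  isoByClasses_mean 8 (by decide) (ofCoords_mem_aeppliZ (by decide) (by decide))
    (ofCoords_mem_aeppliB (by decide) (by decide)) (fun _ => ofCoordsRaw_single_eight _)
    (fun s => by simp [coordDel_coordDelBar_eq_zero_iff])
    (fun s => by simp [exists_coordDel_add_coordDelBar_eq_iff])

lemma aeppliVia_two_zero :
    AeppliVia 2 0 (fun g : SmoothT2 => term g.1 ![dw, dz]) :=
  isoByClasses_smooth 3 (by decide) (ofCoords_mem_aeppliZ (by decide) (by decide))
    (ofCoords_mem_aeppliB (by decide) (by decide)) (fun _ => ofCoordsRaw_single_three _)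
    (fun s => by simp [coordDel_coordDelBar_eq_zero_iff])
    (fun s => by simp [exists_coordDel_add_coordDelBar_eq_iff])

lemma aeppliVia_two_one :
    AeppliVia 2 1 (fun a : ℂ => term (fun _ => a) ![dw, dz, dzBar]) :=
  isoByClasses_mean 7 (by decide) (ofCoords_mem_aeppliZ (by decide) (by decide))
    (ofCoords_mem_aeppliB (by decide) (by decide)) (fun _ => ofCoordsRaw_single_seven _)
    (fun s => by simp [coordDel_coordDelBar_eq_zero_iff])
    (fun s => by simp [exists_coordDel_add_coordDelBar_eq_iff])

lemma aeppliVia_two_two :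
    AeppliVia 2 2 (fun g : SmoothT2 => term g.1 ![dw, dz, dwBar, dzBar]) :=
  isoByClasses_smooth 9 (by decide) (ofCoords_mem_aeppliZ (by decide) (by decide))
    (ofCoords_mem_aeppliB (by decide) (by decide)) (fun _ => ofCoordsRaw_single_nine _)
    (fun s => by simp [coordDel_coordDelBar_eq_zero_iff])
    (fun s => by simp [exists_coordDel_add_coordDelBar_eq_iff])

/-- The coordinates of `g θ + c dz ∧ dz̄`. -/
abbrev coordPair : SmoothT2 × ℂ →ₗ[ℂ] (Fin 10 → SmoothT2) :=
  coordSingle 4 ∘ₗ LinearMap.fst ℂ SmoothT2 ℂ +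
    coordSingle 5 ∘ₗ constT2 ∘ₗ LinearMap.snd ℂ SmoothT2 ℂ

lemma ofCoordsRaw_coordPair (s : SmoothT2 × ℂ) :
    ofCoordsRaw (coordPair s) = mixed s.1.1 + term (fun _ => s.2) ![dz, dzBar] := by
  funext k
  rcases k with _ | _ | _ | _ | _ | k <;> simp [ofCoordsRaw, term, mixed]
  funext x
  ext v
  simp [scaled_apply, thetaForm, constT2_apply, mul_add]

lemma coordType_eq_one_one_iff (j : Fin 10) : coordType j = (1, 1) ↔ j = 4 ∨ j = 5 := by
  revert j
  decide

/-- A cohomology space in bidegree `(1,1)`. -/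
lemma isoByClasses_pair {Y : Type} [AddCommGroup Y] [Module ℂ Y] {K I : Submodule ℂ basicForms}
    {θ : Y × ℂ → RawForm} (ι : Y →ₗ[ℂ] SmoothT2) (hι : Function.Injective ι)
    {A B : (Fin 10 → SmoothT2) → Prop}
    (hK : ∀ f, ofCoords f ∈ K ↔ A f ∧ ∀ j, coordType j ≠ (1, 1) → f j = 0)
    (hI : ∀ f, ofCoords f ∈ I ↔ B f ∧ ∀ j, coordType j ≠ (1, 1) → f j = 0)
    (hθ : ∀ y, ofCoordsRaw (coordPair (ι y.1, y.2)) = θ y)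
    (hA : ∀ f, (∀ j, coordType j ≠ (1, 1) → f j = 0) → (A f ↔ f 4 ∈ LinearMap.range ι))
    (hB : ∀ f, (∀ j, coordType j ≠ (1, 1) → f j = 0) → (B f ↔ f 4 = 0 ∧ meanT2 (f 5) = 0)) :
    IsoByClasses K I θ := by
  have hs : ∀ s, ∀ j, coordType j ≠ (1, 1) → coordPair s j = 0 := by
    intro s j hj
    rw [Ne, coordType_eq_one_one_iff, not_or] at hj
    simp [hj.1, hj.2]
  have h4 : ∀ s, coordPair s 4 = s.1 := fun s => by simp
  have h5 : ∀ s, coordPair s 5 = constT2 s.2 := fun s => by simp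
  refine isoByClasses_of_coords (coordPair ∘ₗ ι.prodMap LinearMap.id) hθ (fun x => ?_)
    (fun x hx => ?_) fun f hf => ?_
  · refine (hK _).2 ⟨(hA _ (hs _)).2 ?_, hs _⟩
    exact ⟨x.1, (h4 (ι x.1, x.2)).symm⟩
  · obtain ⟨e1, e2⟩ := (hB _ (hs _)).1 ((hI _).1 hx).1
    rw [h4] at e1
    rw [h5, meanT2_constT2] at e2
    exact Prod.ext (hι (e1.trans (map_zero ι).symm)) e2
  · obtain ⟨h1, h2⟩ := (hK f).1 hf
    obtain ⟨y, hy⟩ := (hA f h2).1 h1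
    refine ⟨(y, meanT2 (f 5)), (hI _).2 ?_⟩
    have h3 : ∀ j, coordType j ≠ (1, 1) →
        (f - (coordPair ∘ₗ ι.prodMap LinearMap.id) (y, meanT2 (f 5))) j = 0 := by
      intro j hj
      rw [Pi.sub_apply, h2 j hj, zero_sub, neg_eq_zero]
      exact hs _ j hj
    refine ⟨(hB _ h3).2 ⟨?_, ?_⟩, h3⟩
    · rw [Pi.sub_apply, sub_eq_zero]
      exact hy.symm.trans (h4 (ι y, meanT2 (f 5))).symm
    · rw [Pi.sub_apply, map_sub, sub_eq_zero]
      exact ((congrArg meanT2 (h5 (ι y, meanT2 (f 5)))).trans (meanT2_constT2 _)).symm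

lemma mem_range_constT2_iff (s : SmoothT2) :
    s ∈ LinearMap.range constT2 ↔ s = constT2 (meanT2 s) := by
  constructor
  · rintro ⟨c, rfl⟩
    rw [meanT2_constT2]
  · intro h
    exact ⟨_, h.symm⟩

/-- The coefficient of `θ` must be constant, because `∂̄` sends `c θ` to `-∂c/∂z̄` times `dz ∧ dw̄ ∧
dz̄`; that of `dz ∧ dz̄` is free and matters only through its mean. -/
lemma dolbeaultVia_one_one : DolbeaultVia 1 1
    (fun a : ℂ × ℂ => mixed (fun _ => a.1) + term (fun _ => a.2) ![dz, dzBar]) := by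
  refine isoByClasses_pair constT2 constT2_injective
    (ofCoords_mem_dolbeaultZ (by decide) (by decide))
    (ofCoords_mem_dolbeaultB (by decide) (by decide)) (fun y => ofCoordsRaw_coordPair _)
    (fun f hf => ?_) fun f hf => ?_
  all_goals simp only [Ne, coordType_eq_one_one_iff, Fin.forall_fin_succ] at hf
  · rw [coordDelBar_eq_zero_iff, mem_range_constT2_iff]
    simp_all
  · rw [exists_coordDelBar_eq_iff]
    simp_all

lemma bottChernVia_one_one : BottChernVia 1 1
    (fun a : ℂ × ℂ => mixed (fun _ => a.1) + term (fun _ => a.2) ![dz, dzBar]) := by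
  refine isoByClasses_pair constT2 constT2_injective
    (ofCoords_mem_bottChernZ (by decide) (by decide))
    (ofCoords_mem_bottChernB (by decide) (by decide)) (fun y => ofCoordsRaw_coordPair _)
    (fun f hf => ?_) fun f hf => ?_
  all_goals simp only [Ne, coordType_eq_one_one_iff, Fin.forall_fin_succ] at hf
  · rw [coordDel_eq_zero_iff, coordDelBar_eq_zero_iff, mem_range_constT2_iff]
    simp_all
  · rw [exists_coordDel_coordDelBar_eq_iff]
    simp_all [Fin.forall_fin_succ]
    tauto

/-- The form `∂̄(c θ)` already contains `dz` and is killed by `∂`, so `c` is arbitrary, and no exact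
form has a component along `θ`. -/
lemma aeppliVia_one_one : AeppliVia 1 1
    (fun a : SmoothT2 × ℂ => mixed a.1.1 + term (fun _ => a.2) ![dz, dzBar]) := by
  refine isoByClasses_pair LinearMap.id Function.injective_id
    (ofCoords_mem_aeppliZ (by decide) (by decide))
    (ofCoords_mem_aeppliB (by decide) (by decide)) (fun y => ofCoordsRaw_coordPair _)
    (fun f hf => ?_) fun f hf => ?_
  all_goals simp only [Ne, coordType_eq_one_one_iff, Fin.forall_fin_succ] at hf
  · rw [coordDel_coordDelBar_eq_zero_iff]
    simp_all
  · rw [exists_coordDel_add_coordDelBar_eq_iff]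
    simp_all

/-! ### Dimensions and the transverse metric -/

/-- The powers of the character `exp (2 π i x)`, as a linear map on polynomials. -/
def polyT2 : Polynomial ℂ →ₗ[ℂ] SmoothT2 where
  toFun p := ⟨fun z => p.eval (torusChar ![1, 0] z), by
    have h : ContDiff ℝ ∞ (torusChar ![1, 0]) := (freq ![1, 0]).contDiff.cexp
    have hp : ContDiff ℝ ∞ fun z : ℂ => p.eval z := by
      simpa using (p.contDiff_aeval (R := ℂ) (𝕜 := ℂ) ∞).restrict_scalars ℝ
    exact hp.comp h, fun m n z => congrArg (p.eval ·) (torusChar_add_gauss _ m n z)⟩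
  map_add' p q := by ext z; exact Polynomial.eval_add
  map_smul' c p := by ext z; exact Polynomial.eval_smul ..

/-- The character is injective on the real interval `[0, 1)`, so a polynomial in the kernel has
infinitely many roots. -/
lemma polyT2_injective : Function.Injective polyT2 := by
  rw [← LinearMap.ker_eq_bot, LinearMap.ker_eq_bot']
  intro p hp
  refine Polynomial.eq_zero_of_infinite_isRoot p ?_
  have hi : (Set.Ico (0 : ℝ) 1).Infinite := Set.Ico_infinite one_pos
  refine Set.infinite_of_injOn_mapsTo (f := fun x : ℝ => torusChar ![1, 0] (x : ℂ)) ?_ ?_ hi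
  · intro x hx y hy h
    simp only [torusChar, freq_apply, Complex.exp_eq_exp_iff_exists_int] at h
    obtain ⟨n, hn⟩ := h
    have h2 : (x : ℂ) = y + n := by
      have h0 : (2 * Real.pi * Complex.I : ℂ) ≠ 0 := Complex.two_pi_I_ne_zero
      apply mul_left_cancel₀ h0
      simp at hn
      linear_combination hn
    have h3 : x = y + n := by exact_mod_cast h2
    have h4 : (-1 : ℝ) < n := by linarith [hx.1, hy.2]
    have h5 : (n : ℝ) < 1 := by linarith [hx.2, hy.1]
    have h6 : -1 < n := by exact_mod_cast h4
    have h7 : n < 1 := by exact_mod_cast h5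
    have h8 : n = 0 := by omega
    rw [h3, h8]
    simp
  · intro x _
    exact congrFun (congrArg Subtype.val hp) (x : ℂ)

lemma not_finite_smoothT2 : ¬ FiniteDimensional ℂ SmoothT2 := by
  intro h
  have := Module.Finite.of_injective polyT2 polyT2_injective
  exact Polynomial.not_finite this

lemma not_finite_smoothT2_prod : ¬ FiniteDimensional ℂ (SmoothT2 × ℂ) := fun _ =>
  not_finite_smoothT2 (Module.Finite.of_surjective (LinearMap.fst ℂ SmoothT2 ℂ)
    LinearMap.fst_surjective)

/-- At the fixed point `0`, invariance on `(0, 1)` and `(1, 0)` adds the square length of `(1, 0)`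
to their inner product and so forces it to vanish. -/
lemma not_exists_transverseMetric : ¬ ∃ g, IsTransverseMetric g := by
  rintro ⟨g, hg⟩
  have h := hg.invariant 0 (0, 1) (1, 0)
  have e1 : shear ((0, 1) : ℂ × ℂ) = (0, 1) + (1, 0) := by simp [shear]
  have e2 : shear ((1, 0) : ℂ × ℂ) = (1, 0) := by simp [shear]
  rw [map_zero, e1, e2, map_add, add_apply, add_eq_left] at h
  exact (hg.pos 0 (1, 0) (by simp)).ne' h

lemma IsoByClasses.finite_iff {X : Type} [AddCommGroup X] [Module ℂ X]
    {K I : Submodule ℂ basicForms} {θ : X → RawForm} (h : IsoByClasses K I θ) :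
    FiniteDimensional ℂ (QuotBy K I) ↔ FiniteDimensional ℂ X := by
  obtain ⟨e, -⟩ := h
  exact ⟨fun _ => Module.Finite.equiv e.symm, fun _ => Module.Finite.equiv e⟩

/-- Since `ℂ` is finite over `ℝ`, finiteness over either field is the same property. -/
lemma finite_of_real_equiv {V W : Type*} [AddCommGroup V] [AddCommGroup W] [Module ℂ V]
    [Module ℂ W] [Module ℝ V] [Module ℝ W] [IsScalarTower ℝ ℂ V] [IsScalarTower ℝ ℂ W]
    (e : V ≃ₗ[ℝ] W) [FiniteDimensional ℂ V] : FiniteDimensional ℂ W := by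
  have : Module.Finite ℝ V := Module.Finite.trans ℂ V
  have : Module.Finite ℝ W := Module.Finite.equiv e
  exact Module.Finite.of_restrictScalars_finite ℝ ℂ W

/-- Spaces of which exactly one has finite dimension are not isomorphic over the reals. -/
lemma not_real_equiv_of_finite {V W : Type*} [AddCommGroup V] [AddCommGroup W] [Module ℂ V]
    [Module ℂ W] [Module ℝ V] [Module ℝ W] [IsScalarTower ℝ ℂ V] [IsScalarTower ℝ ℂ W]
    (h : ¬ (FiniteDimensional ℂ V ↔ FiniteDimensional ℂ W)) : ¬ Nonempty (V ≃ₗ[ℝ] W) :=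
  fun ⟨e⟩ => h ⟨fun _ => finite_of_real_equiv e, fun _ => finite_of_real_equiv e.symm⟩

lemma finite_dual_iff {V : Type*} [AddCommGroup V] [Module ℂ V] :
    FiniteDimensional ℂ (Module.Dual ℂ V) ↔ FiniteDimensional ℂ V :=
  Module.finite_dual_iff ℂ

lemma finite_bottChern_iff {p q : ℕ} (hp : p ≤ 2) (hq : q ≤ 2) :
    FiniteDimensional ℂ (BottChern p q) ↔ p + q ≤ 2 := by
  have hS := not_finite_smoothT2
  interval_cases p <;> interval_cases q
  · exact iff_of_true (bottChernVia_zero_zero.finite_iff.2 inferInstance) (by decide)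
  · exact iff_of_true (bottChernVia_zero_one.finite_iff.2 inferInstance) (by decide)
  · exact iff_of_true (bottChernVia_zero_two.finite_iff.2 inferInstance) (by decide)
  · exact iff_of_true (bottChernVia_one_zero.finite_iff.2 inferInstance) (by decide)
  · exact iff_of_true (bottChernVia_one_one.finite_iff.2 inferInstance) (by decide)
  · exact iff_of_false (fun h => hS (bottChernVia_one_two.finite_iff.1 h)) (by decide)
  · exact iff_of_true (bottChernVia_two_zero.finite_iff.2 inferInstance) (by decide)
  · exact iff_of_false (fun h => hS (bottChernVia_two_one.finite_iff.1 h)) (by decide)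
  · exact iff_of_false (fun h => hS (bottChernVia_two_two.finite_iff.1 h)) (by decide)

lemma finite_aeppli_iff {p q : ℕ} (hp : p ≤ 2) (hq : q ≤ 2) :
    FiniteDimensional ℂ (Aeppli p q) ↔ p + q ≠ 2 ∧ p + q ≠ 4 := by
  have hS := not_finite_smoothT2
  have hS2 := not_finite_smoothT2_prod
  interval_cases p <;> interval_cases q
  · exact iff_of_true (aeppliVia_zero_zero.finite_iff.2 inferInstance) (by decide)
  · exact iff_of_true (aeppliVia_zero_one.finite_iff.2 inferInstance) (by decide)
  · exact iff_of_false (fun h => hS (aeppliVia_zero_two.finite_iff.1 h)) (by decide)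
  · exact iff_of_true (aeppliVia_one_zero.finite_iff.2 inferInstance) (by decide)
  · exact iff_of_false (fun h => hS2 (aeppliVia_one_one.finite_iff.1 h)) (by decide)
  · exact iff_of_true (aeppliVia_one_two.finite_iff.2 inferInstance) (by decide)
  · exact iff_of_false (fun h => hS (aeppliVia_two_zero.finite_iff.1 h)) (by decide)
  · exact iff_of_true (aeppliVia_two_one.finite_iff.2 inferInstance) (by decide)
  · exact iff_of_false (fun h => hS (aeppliVia_two_two.finite_iff.1 h)) (by decide)

lemma finite_dolbeault_iff {p q : ℕ} (hp : p ≤ 2) (hq : q ≤ 2) :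
    FiniteDimensional ℂ (Dolbeault p q) ↔ (p, q) ≠ (0, 2) ∧ (p, q) ≠ (2, 2) := by
  have hS := not_finite_smoothT2
  interval_cases p <;> interval_cases q
  · exact iff_of_true (dolbeaultVia_zero_zero.finite_iff.2 inferInstance) (by decide)
  · exact iff_of_true (dolbeaultVia_zero_one.finite_iff.2 inferInstance) (by decide)
  · exact iff_of_false (fun h => hS (dolbeaultVia_zero_two.finite_iff.1 h)) (by decide)
  · exact iff_of_true (dolbeaultVia_one_zero.finite_iff.2 inferInstance) (by decide)
  · exact iff_of_true (dolbeaultVia_one_one.finite_iff.2 inferInstance) (by decide)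
  · exact iff_of_true (dolbeaultVia_one_two.finite_iff.2 inferInstance) (by decide)
  · exact iff_of_true (dolbeaultVia_two_zero.finite_iff.2 inferInstance) (by decide)
  · exact iff_of_true (dolbeaultVia_two_one.finite_iff.2 inferInstance) (by decide)
  · exact iff_of_false (fun h => hS (dolbeaultVia_two_two.finite_iff.1 h)) (by decide)

end TorusSuspension

end

theorem mainTheorem7 :
    -- Dolbeault table
    (DolbeaultVia 0 0 (fun a : ℂ => term (fun _ => a) ![]) ∧
      DolbeaultVia 1 0 (fun a : ℂ => term (fun _ => a) ![dz]) ∧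
      DolbeaultVia 2 0 (fun a : ℂ => term (fun _ => a) ![dw, dz]) ∧
      DolbeaultVia 0 1 (fun a : ℂ => term (fun _ => a) ![dzBar]) ∧
      DolbeaultVia 1 1
        (fun a : ℂ × ℂ => mixed (fun _ => a.1) + term (fun _ => a.2) ![dz, dzBar]) ∧
      DolbeaultVia 2 1 (fun a : ℂ => term (fun _ => a) ![dw, dz, dzBar]) ∧
      DolbeaultVia 0 2 (fun g : SmoothT2 => term g.1 ![dwBar, dzBar]) ∧
      DolbeaultVia 1 2 (fun a : ℂ => term (fun _ => a) ![dz, dwBar, dzBar]) ∧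
      DolbeaultVia 2 2 (fun g : SmoothT2 => term g.1 ![dw, dz, dwBar, dzBar])) ∧
    -- Bott-Chern table
    (BottChernVia 0 0 (fun a : ℂ => term (fun _ => a) ![]) ∧
      BottChernVia 1 0 (fun a : ℂ => term (fun _ => a) ![dz]) ∧
      BottChernVia 2 0 (fun a : ℂ => term (fun _ => a) ![dw, dz]) ∧
      BottChernVia 0 1 (fun a : ℂ => term (fun _ => a) ![dzBar]) ∧
      BottChernVia 1 1
        (fun a : ℂ × ℂ => mixed (fun _ => a.1) + term (fun _ => a.2) ![dz, dzBar]) ∧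
      BottChernVia 2 1 (fun g : SmoothT2 => term g.1 ![dw, dz, dzBar]) ∧
      BottChernVia 0 2 (fun a : ℂ => term (fun _ => a) ![dwBar, dzBar]) ∧
      BottChernVia 1 2 (fun g : SmoothT2 => term g.1 ![dz, dwBar, dzBar]) ∧
      BottChernVia 2 2 (fun g : SmoothT2 => term g.1 ![dw, dz, dwBar, dzBar])) ∧
    -- Aeppli table
    (AeppliVia 0 0 (fun a : ℂ => term (fun _ => a) ![]) ∧
      AeppliVia 1 0 (fun a : ℂ => term (fun _ => a) ![dz]) ∧
      AeppliVia 2 0 (fun g : SmoothT2 => term g.1 ![dw, dz]) ∧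
      AeppliVia 0 1 (fun a : ℂ => term (fun _ => a) ![dzBar]) ∧
      AeppliVia 1 1
        (fun a : SmoothT2 × ℂ => mixed a.1.1 + term (fun _ => a.2) ![dz, dzBar]) ∧
      AeppliVia 2 1 (fun a : ℂ => term (fun _ => a) ![dw, dz, dzBar]) ∧
      AeppliVia 0 2 (fun g : SmoothT2 => term g.1 ![dwBar, dzBar]) ∧
      AeppliVia 1 2 (fun a : ℂ => term (fun _ => a) ![dz, dwBar, dzBar]) ∧
      AeppliVia 2 2 (fun g : SmoothT2 => term g.1 ![dw, dz, dwBar, dzBar])) ∧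
    -- infinite and finite dimension
    (¬ FiniteDimensional ℂ (Aeppli 2 0) ∧ ¬ FiniteDimensional ℂ (Aeppli 1 1) ∧
      ¬ FiniteDimensional ℂ (Aeppli 0 2) ∧ ¬ FiniteDimensional ℂ (Aeppli 2 2) ∧
      FiniteDimensional ℂ (Dolbeault 1 1)) ∧
    -- no invariant transverse Riemannian metric
    (¬ ∃ g, IsTransverseMetric g) ∧
    -- failure of the duality between Bott-Chern and Aeppli cohomology
    (∀ p ≤ 2, ∀ q ≤ 2, (p, q) ≠ (1, 0) → (p, q) ≠ (0, 1) →
      ¬ Nonempty (BottChern p q ≃ₗ[ℝ] Aeppli (2 - p) (2 - q))) ∧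
    -- failure of Serre duality
    (∀ p ≤ 2, ∀ q ≤ 2, p = q ∧ p ≠ 1 ∨ (p, q) = (2, 0) ∨ (p, q) = (0, 2) →
      ¬ Nonempty (Dolbeault p q ≃ₗ[ℝ] Module.Dual ℂ (Dolbeault (2 - p) (2 - q))) ∧
      ¬ Nonempty (Dolbeault p q ≃ₗ[ℝ] Dolbeault (2 - p) (2 - q))) := by
  refine ⟨⟨dolbeaultVia_zero_zero, dolbeaultVia_one_zero, dolbeaultVia_two_zero,
      dolbeaultVia_zero_one, dolbeaultVia_one_one, dolbeaultVia_two_one, dolbeaultVia_zero_two,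
      dolbeaultVia_one_two, dolbeaultVia_two_two⟩,
    ⟨bottChernVia_zero_zero, bottChernVia_one_zero, bottChernVia_two_zero, bottChernVia_zero_one,
      bottChernVia_one_one, bottChernVia_two_one, bottChernVia_zero_two, bottChernVia_one_two,
      bottChernVia_two_two⟩,
    ⟨aeppliVia_zero_zero, aeppliVia_one_zero, aeppliVia_two_zero, aeppliVia_zero_one,
      aeppliVia_one_one, aeppliVia_two_one, aeppliVia_zero_two, aeppliVia_one_two,
      aeppliVia_two_two⟩,
    ⟨?_, ?_, ?_, ?_, ?_⟩, not_exists_transverseMetric, fun p hp q hq h1 h2 => ?_,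
    fun p hp q hq h => ⟨?_, ?_⟩⟩
  · exact fun h => absurd ((finite_aeppli_iff (by decide) (by decide)).1 h) (by decide)
  · exact fun h => absurd ((finite_aeppli_iff (by decide) (by decide)).1 h) (by decide)
  · exact fun h => absurd ((finite_aeppli_iff (by decide) (by decide)).1 h) (by decide)
  · exact fun h => absurd ((finite_aeppli_iff (by decide) (by decide)).1 h) (by decide)
  · exact (finite_dolbeault_iff (by decide) (by decide)).2 (by decide)
  · refine not_real_equiv_of_finite ?_
    rw [finite_bottChern_iff hp hq, finite_aeppli_iff (Nat.sub_le 2 p) (Nat.sub_le 2 q)]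
    simp only [ne_eq, Prod.mk.injEq] at h1 h2
    omega
  · refine not_real_equiv_of_finite ?_
    rw [finite_dual_iff, finite_dolbeault_iff hp hq,
      finite_dolbeault_iff (Nat.sub_le 2 p) (Nat.sub_le 2 q)]
    simp only [ne_eq, Prod.mk.injEq] at h ⊢
    omega
  · refine not_real_equiv_of_finite ?_
    rw [finite_dolbeault_iff hp hq, finite_dolbeault_iff (Nat.sub_le 2 p) (Nat.sub_le 2 q)]
    simp only [ne_eq, Prod.mk.injEq] at h ⊢
    omega
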